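/- Let $c>1$, $d>\sqrt2$. For $\nu>0$ let $G_1=x_1y_2-x_2y_1$, $G_2=\frac{x_1^2+x_2^2}{2}-\frac{y_1^2+y_2^2}{2}+\big(\frac{y_1^2+y_2^2}{2}\big)^2$, $H_0=G_1+\nu G_2$ on $(\mathbb R^4,\,dx_1\wedge dy_1+dx_2\wedge dy_2)$, and let $H_1=\dfrac{y_1^5}{(d-y_1)(c-\cos\theta)}$ with $\theta=\gamma t+\theta_0$, $\gamma\in\mathbb R\setminus\mathbb Q$. Let $\zeta_{\psi_0}$ be the homoclinic orbits of $H_0$, given with $\psi=t+\psi_0$ by $y=\sqrt2\,\mathrm{sech}(\nu t)(\cos\psi,\sin\psi)$, $x=\sqrt2\,\mathrm{sech}(\nu t)\tanh(\nu t)(\cos\psi,\sin\psi)$, let $M_i(\psi_0,\theta_0)=\int_{\mathbb R}\{G_i,H_1\}\circ\zeta_{\psi_0}(t)\,dt$ ($i=1,2$) be the Poincaré–Melnikov functions, and for integers $m_1\ge1$, $m_2\neq0$ let $C^{(i)}_{m_1,m_2}$ be the absolute value of the coefficient of $\sin(m_1\psi_0-m_2\theta_0)$ in the Fourier expansion of $M_i$.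 Define $c_{s,m_1/m_2}>0$ by $|m_1-\gamma m_2|=\frac1{c_{s,m_1/m_2}m_1}$ and put $L=c_{s,m_1/m_2}\,\nu\,m_1^2$. For $L>0$ define $$\Psi_1(L)=\sqrt L\,\big(\Psi_{1,1}(L)+\Psi_{1,2}(L)\big),\qquad \Psi_{1,1}(L)=-\Big(K+\log L+\frac{\pi}{2L}\Big),$$ $$K=\log d+\tfrac12\log2+\frac{\log(c+\sqrt{c^2-1})}{|\gamma|}-1,$$ $$\Psi_{1,2}(L)=-2I\log(Ld)-(1+I)\log(1+I)-I\log I+I(2-\log2)+\tfrac12(1+2I)\big(\log(1+((1+2I)L)^2)-2\big)+\frac{\arctan((1+2I)L)}{L},$$ where $I=I(L)>0$ is the positive root of $(2d^2-4)(I^2+I)=1+L^{-2}$. Put $\Psi_2(L)=\Psi_1(L)-\dfrac{\sqrt L\log L}{m_1}$. Then $\Psi_1$ depends on $\gamma$ only through the term $\log(c+\sqrt{c^2-1})/|\gamma|$ in $K$, that is, $\Psi_1(L)=\Phi(L)-\sqrt L\,\log(c+\sqrt{c^2-1})/|\gamma|$ with $\Phi$ independent of $\gamma$ (and of $m_1,m_2,\nu$).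 Moreover, for every irrational $\gamma$ and all $0<L_-\le L_+$: (i) there are $A>0$ and $\nu_0\in(0,1)$ such that for all $\nu\in(0,\nu_0)$ and all integers $m_1\ge1$, $m_2\ne0$ with $L=c_{s,m_1/m_2}\nu m_1^2\in[L_-,L_+]$, one has $C^{(1)}_{m_1,m_2},C^{(2)}_{m_1,m_2}>0$ and, for $i=1,2$, $$\Big|\Psi_i(L)-\sqrt{c_{s,m_1/m_2}\nu}\,\log C^{(i)}_{m_1,m_2}\Big|\le A\Big(\sqrt{c_{s,m_1/m_2}\nu}\,\log\tfrac1\nu+\nu\Big),$$ so the approximation holds up to the contribution of finite powers of $\nu$ in $C^{(i)}_{m_1,m_2}$; (ii) along every sequence of such triples $(\nu,m_1,m_2)$, with $L\in[L_-,L_+]$, for which $\nu\to0^+$ and $\sqrt{c_{s,m_1/m_2}\nu}\,\log\nu\to0$ (for instance whenever the constants $c_{s,m_1/m_2}$ stay bounded), $$\Psi_i(L)-\sqrt{c_{s,m_1/m_2}\nu}\,\log C^{(i)}_{m_1,m_2}\longrightarrow0,\qquad i=1,2.$$ -/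

import Mathlib

open Real Filter Topology

namespace HamiltonianHopf

noncomputable section

/-! Phase space is `ℝ⁴` with coordinates `(x₁, x₂, y₁, y₂)` and symplectic form
`dx₁ ∧ dy₁ + dx₂ ∧ dy₂`. The unperturbed Hamiltonian is `H₀ = G₁ + ν G₂`. -/

/-- Functions of the phase space coordinates `(x₁, x₂, y₁, y₂)`. -/
abbrev Observable : Type := ℝ → ℝ → ℝ → ℝ → ℝ

/-- The first integral `G₁ = x₁ y₂ - x₂ y₁` of `H₀`. -/
def G₁ : Observable := fun x₁ x₂ y₁ y₂ => x₁ * y₂ - x₂ * y₁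

/-- The first integral `G₂ = (x₁² + x₂²)/2 - (y₁² + y₂²)/2 + ((y₁² + y₂²)/2)²` of `H₀`. -/
def G₂ : Observable := fun x₁ x₂ y₁ y₂ =>
  (x₁ ^ 2 + x₂ ^ 2) / 2 - (y₁ ^ 2 + y₂ ^ 2) / 2 + ((y₁ ^ 2 + y₂ ^ 2) / 2) ^ 2

/-- The perturbation `H₁ = y₁⁵ / ((d - y₁) (c - cos θ))`, at the time phase `θ`. -/
def H₁ (c d θ : ℝ) : Observable := fun _ _ y₁ _ => y₁ ^ 5 / ((d - y₁) * (c - cos θ))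

/-- The Poisson bracket
`{F, G} = ∂F/∂x₁ ∂G/∂y₁ - ∂F/∂y₁ ∂G/∂x₁ + ∂F/∂x₂ ∂G/∂y₂ - ∂F/∂y₂ ∂G/∂x₂`. -/
def poissonBracket (F G : Observable) : Observable := fun x₁ x₂ y₁ y₂ =>
  (deriv (fun u => F u x₂ y₁ y₂) x₁ * deriv (fun u => G x₁ x₂ u y₂) y₁
    - deriv (fun u => F x₁ x₂ u y₂) y₁ * deriv (fun u => G u x₂ y₁ y₂) x₁)
  + (deriv (fun u => F x₁ u y₁ y₂) x₂ * deriv (fun u => G x₁ x₂ y₁ u) y₂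
    - deriv (fun u => F x₁ x₂ y₁ u) y₂ * deriv (fun u => G x₁ u y₁ y₂) x₂)

/-- Value of `F` at time `t` along the homoclinic orbit of `H₀ = G₁ + ν G₂` with phase `ψ₀`:
`x = r(t) (cos (t + ψ₀), sin (t + ψ₀))`, `y = R(t) (cos (t + ψ₀), sin (t + ψ₀))`, where
`R(t) = √2 sech (ν t)` and `r(t) = √2 sech (ν t) tanh (ν t)`. -/
def alongHomoclinic (ν ψ₀ : ℝ) (F : Observable) (t : ℝ) : ℝ :=
  F (√2 / cosh (ν * t) * tanh (ν * t) * cos (t + ψ₀))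
    (√2 / cosh (ν * t) * tanh (ν * t) * sin (t + ψ₀))
    (√2 / cosh (ν * t) * cos (t + ψ₀))
    (√2 / cosh (ν * t) * sin (t + ψ₀))

/-- The Poincaré–Melnikov function of the first integral `G`:
`M(ψ₀, θ₀) = ∫ {G, H₁}` along the homoclinic orbit of phase `ψ₀`, with `θ = γ t + θ₀`. -/
def melnikov (c d γ ν : ℝ) (G : Observable) (ψ₀ θ₀ : ℝ) : ℝ :=
  ∫ t : ℝ, alongHomoclinic ν ψ₀ (poissonBracket G (H₁ c d (γ * t + θ₀))) t

/-- The coefficient of `sin (m₁ ψ₀ - m₂ θ₀)` in the Fourier expansion of `melnikov`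
(for `m₁ ≥ 1`). -/
def fourierSinCoeff (c d γ ν : ℝ) (G : Observable) (m₁ m₂ : ℤ) : ℝ :=
  (1 / (2 * π ^ 2)) * ∫ ψ₀ in (0 : ℝ)..(2 * π), ∫ θ₀ in (0 : ℝ)..(2 * π),
    melnikov c d γ ν G ψ₀ θ₀ * sin (m₁ * ψ₀ - m₂ * θ₀)

/-- The amplitude `C^{(1)}_{m₁,m₂}`. -/
def C₁ (c d γ ν : ℝ) (m₁ m₂ : ℤ) : ℝ := |fourierSinCoeff c d γ ν G₁ m₁ m₂|

/-- The amplitude `C^{(2)}_{m₁,m₂}`. -/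
def C₂ (c d γ ν : ℝ) (m₁ m₂ : ℤ) : ℝ := |fourierSinCoeff c d γ ν G₂ m₁ m₂|

/-- The constant `c_s` defined by `|m₁ - γ m₂| = 1 / (c_s m₁)`. -/
def cs (γ : ℝ) (m₁ m₂ : ℤ) : ℝ := 1 / (m₁ * |(m₁ : ℝ) - γ * m₂|)

/-- `L = c_s ν m₁²`. -/
def scaledL (γ ν : ℝ) (m₁ m₂ : ℤ) : ℝ := cs γ m₁ m₂ * ν * (m₁ : ℝ) ^ 2

/-- `ρ_c = c + √(c² - 1)`. -/
def rho (c : ℝ) : ℝ := c + √(c ^ 2 - 1)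

/-- `K = log d + (log 2)/2 + (log ρ_c)/|γ| - 1`. -/
def K (c d γ : ℝ) : ℝ := log d + log 2 / 2 + log (rho c) / |γ| - 1

/-- The positive root `I` of `(2 d² - 4) (I² + I) = 1 + 1/L²`. -/
def Istar (d L : ℝ) : ℝ := (-1 + √(1 + 4 * (1 + 1 / L ^ 2) / (2 * d ^ 2 - 4))) / 2

/-- `Ψ₁,₁(L) = -(K + log L + π / (2 L))`. -/
def Psi11 (c d γ L : ℝ) : ℝ := -(K c d γ + log L + π / 2 / L)

/-- `Ψ₁,₂(L)`, the contribution of the dominant term of the sum. -/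
def Psi12 (d L : ℝ) : ℝ :=
  -2 * Istar d L * log (L * d) - (1 + Istar d L) * log (1 + Istar d L)
    - Istar d L * log (Istar d L) + Istar d L * (2 - log 2)
    + (1 + 2 * Istar d L) * (log (1 + ((1 + 2 * Istar d L) * L) ^ 2) - 2) / 2
    + arctan ((1 + 2 * Istar d L) * L) / L

/-- The universal function `Ψ₁(L)`. -/
def Psi1 (c d γ L : ℝ) : ℝ := √L * (Psi11 c d γ L + Psi12 d L)

/-- The function `Ψ₂(L) = Ψ₁(L) - √L log L / m₁`. -/
def Psi2 (c d γ : ℝ) (m₁ : ℤ) (L : ℝ) : ℝ := Psi1 c d γ L - √L * log L / m₁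

end

end HamiltonianHopf

open HamiltonianHopf

/-!
Along a homoclinic orbit only `∂H₁/∂y₁` enters the Poisson brackets, so with `f(y) = y⁵ / (d - y)`
the two Melnikov integrands are `y₂ f'(y₁) / (c - cos θ)` and `x₁ f'(y₁) / (c - cos θ)`. Fubini and
a shift of both phases along the flow separate the variables: the coefficient of
`sin (m₁ ψ₀ - m₂ θ₀)` is the `m₂`-th Fourier coefficient of `1 / (c - cos θ)`, which is exactly
geometric in `|m₂|` (`poissonFourier_eq`), times an oscillatory integral in `t` of frequency
`m₁ - γ m₂`. Expanding `f` in powers of `y₁` and integrating by parts in time, the coefficients for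
`G₁` and `G₂` differ exactly by the factor `L` (`C₂_eq`), which accounts for the difference
`Ψ₁ - Ψ₂ = √L log L / m₁`. Hence only the first amplitude has to be estimated.

By `hasSum_fourierSinCoeff_G₁`, that amplitude is an explicit prefactor times a series over
`n = m₁ + 2 j`, whose terms are positive multiples of binomial coefficients and of
`∫ sechⁿ(s) cos (ξ s) ds = 2ⁿ⁻¹ |Γ((n + i ξ) / 2)|² / Γ(n)`, where `ξ = m₁ / L`. As there is no
cancellation, Laplace's method applies directly. Telescoping the recursion in `n` gives the size of
these integrals up to polynomial factors (`sechFourier_bounds`), so that the `j`-th term is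
`exp (rate d ξ m₁ j)` up to polynomial factors. The derivative of the rate is the logarithm of a
rational function, which vanishes at `j = I m₁` exactly when `(2 d² - 4) (I² + I) = 1 + 1 / L²`, and
the maximal rate is `m₁ (Ψ₁,₁ + Ψ₁,₂ + log ρ_c / |γ|)` (`rate_max_eq`). The term next to the maximum
bounds the sum from below; the linear decay of the rate beyond twice the maximum bounds it from
above (`log_amplitude_bound`).

It remains to replace `|m₂| log ρ_c` by `m₁ log ρ_c / |γ|`, at a cost of `O(ν)` after normalization,
and to absorb `log m₁` through `log m₁ ≤ log (1 / ν) + m₁ ν`. The series starts at the fifth power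
of `y₁`, so this analysis needs `m₁ ≥ 5`; since `γ` is irrational, small orders `m₁` are excluded by
`L ≥ Lmin` once `ν` is small (`exists_forall_le_order`).
-/

namespace HamiltonianHopf

open MeasureTheory Set

/-! ### Fourier integrals of powers of `sech` -/

lemma one_add_sq_div_two_le_cosh (s : ℝ) : 1 + s ^ 2 / 2 ≤ cosh s := by
  have h1 : cosh s = 1 + 2 * sinh (s / 2) ^ 2 := by
    have h := Real.cosh_two_mul (s / 2)
    have h' := Real.cosh_sq (s / 2)
    rw [show 2 * (s / 2) = s by ring] at h
    linarith
  have h2 : (s / 2) ^ 2 ≤ sinh (s / 2) ^ 2 := by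
    rcases le_total 0 (s / 2) with h | h
    · exact pow_le_pow_left₀ h (Real.self_le_sinh_iff.2 h) 2
    · have := Real.self_le_sinh_iff.2 (show 0 ≤ -(s / 2) by linarith)
      rw [Real.sinh_neg] at this
      nlinarith
  nlinarith

lemma integrable_sech : Integrable fun s : ℝ => 1 / cosh s := by
  refine (integrable_inv_one_add_sq.const_mul 2).mono' ?_ ?_
  · exact (continuous_const.div Real.continuous_cosh fun s => (cosh_pos s).ne').aestronglyMeasurable
  · refine Eventually.of_forall fun s => ?_
    rw [Real.norm_of_nonneg (by positivity [cosh_pos s]), ← div_eq_mul_inv,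
      div_le_div_iff₀ (cosh_pos s) (by positivity)]
    nlinarith [one_add_sq_div_two_le_cosh s]

lemma hasDerivAt_logistic (s : ℝ) :
    HasDerivAt (fun s : ℝ => exp s / (2 * cosh s)) (1 / (2 * cosh s ^ 2)) s := by
  have h := (Real.hasDerivAt_exp s).div ((Real.hasDerivAt_cosh s).const_mul 2)
    (by have := cosh_pos s; positivity)
  refine h.congr_deriv ?_
  have := cosh_pos s
  have h2 : exp s = cosh s + sinh s := (Real.cosh_add_sinh s).symm
  have h3 := Real.cosh_sq s
  rw [h2]
  field_simp
  nlinarith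

lemma one_sub_logistic (s : ℝ) : 1 - exp s / (2 * cosh s) = exp (-s) / (2 * cosh s) := by
  have := cosh_pos s
  field_simp
  rw [Real.cosh_eq]; ring

lemma logistic_image : (fun s : ℝ => exp s / (2 * cosh s)) '' univ = Ioo 0 1 := by
  ext x
  constructor
  · rintro ⟨s, -, rfl⟩
    have := cosh_pos s
    refine ⟨by positivity, ?_⟩
    have h := one_sub_logistic s
    have : 0 < exp (-s) / (2 * cosh s) := by positivity
    simp only
    linarith
  · rintro ⟨h0, h1⟩
    have h1' : 0 < 1 - x := by linarith
    refine ⟨log (x / (1 - x)) / 2, mem_univ _, ?_⟩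
    set e := exp (log (x / (1 - x)) / 2) with he
    have he0 : 0 < e := exp_pos _
    have he2 : e * e = x / (1 - x) := by
      rw [he, ← exp_add, add_halves, exp_log (by positivity)]
    simp only
    rw [Real.cosh_eq, Real.exp_neg, ← he]
    have : e * e * (1 - x) = x := by rw [he2]; field_simp
    field_simp
    nlinarith

/-- The substitution `x = (1 + tanh s) / 2` turns Euler's Beta integral into a Fourier integral
of a power of `sech`. -/
lemma betaIntegral_eq_integral_sech (n : ℕ) (ξ : ℝ) :
    Complex.betaIntegral ((n + ξ * Complex.I) / 2) ((n - ξ * Complex.I) / 2)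
      = 2 / 2 ^ n * ∫ s : ℝ, ((1 / cosh s : ℝ) : ℂ) ^ n * Complex.exp (ξ * s * Complex.I) := by
  rw [Complex.betaIntegral, intervalIntegral.integral_of_le zero_le_one,
    integral_Ioc_eq_integral_Ioo, ← logistic_image,
    integral_image_eq_integral_abs_deriv_smul MeasurableSet.univ
      (fun s _ => (hasDerivAt_logistic s).hasDerivWithinAt), ← integral_const_mul, setIntegral_univ]
  · congr 1
    ext s
    have hc := cosh_pos s
    have h1 : (0 : ℝ) < exp s / (2 * cosh s) := by positivity
    have h2 : (0 : ℝ) < exp (-s) / (2 * cosh s) := by positivity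
    rw [show (1 : ℂ) - ((exp s / (2 * cosh s) : ℝ) : ℂ) = ((exp (-s) / (2 * cosh s) : ℝ) : ℂ) by
      rw [← one_sub_logistic]; push_cast; ring]
    rw [Complex.cpow_def_of_ne_zero (by exact_mod_cast h1.ne'),
      Complex.cpow_def_of_ne_zero (by exact_mod_cast h2.ne'), ← Complex.ofReal_log h1.le,
      ← Complex.ofReal_log h2.le, Real.log_div (exp_pos _).ne' (by positivity),
      Real.log_div (exp_pos _).ne' (by positivity), Real.log_exp, Real.log_exp, ← Complex.exp_add]
    set ℓ := Real.log (2 * cosh s) with hℓ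
    rw [show ((s - ℓ : ℝ) : ℂ) * ((n + ξ * Complex.I) / 2 - 1)
        + ((-s - ℓ : ℝ) : ℂ) * ((n - ξ * Complex.I) / 2 - 1)
        = ξ * s * Complex.I + ((2 * ℓ : ℝ) : ℂ) + ((n : ℕ) : ℂ) * ((-ℓ : ℝ) : ℂ) by push_cast; ring,
      Complex.exp_add, Complex.exp_add, Complex.exp_nat_mul, ← Complex.ofReal_exp,
      ← Complex.ofReal_exp, two_mul ℓ, Real.exp_add, Real.exp_neg, hℓ,
      Real.exp_log (by positivity), abs_of_pos (by positivity), Complex.real_smul]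
    have hc' : Complex.cosh s ≠ 0 := by exact_mod_cast hc.ne'
    push_cast
    field_simp
    rw [← mul_pow]
    congr 1
    field_simp
  · have : StrictMono fun s : ℝ => exp s / (2 * cosh s) := by
      apply strictMono_of_deriv_pos
      intro s
      rw [(hasDerivAt_logistic s).deriv]
      have := cosh_pos s
      positivity
    exact this.injective.injOn

/-- The Fourier transform `∫ sechⁿ(s) cos (ξ s) ds` of a power of `sech`. -/
noncomputable def sechFourier (n : ℕ) (ξ : ℝ) : ℝ := ∫ s : ℝ, (1 / cosh s) ^ n * cos (ξ * s)

lemma continuous_sech : Continuous fun s : ℝ => 1 / cosh s :=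
  continuous_const.div Real.continuous_cosh fun s => (cosh_pos s).ne'

lemma sech_nonneg (s : ℝ) : 0 ≤ 1 / cosh s := by have := cosh_pos s; positivity

lemma sech_le_one (s : ℝ) : 1 / cosh s ≤ 1 := (div_le_one (cosh_pos s)).2 (one_le_cosh s)

lemma sech_pow_le {n : ℕ} (hn : n ≠ 0) (s : ℝ) : (1 / cosh s) ^ n ≤ 1 / cosh s :=
  pow_le_of_le_one (sech_nonneg s) (sech_le_one s) hn

lemma integrable_sech_pow {n : ℕ} (hn : n ≠ 0) : Integrable fun s : ℝ => (1 / cosh s) ^ n := by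
  refine integrable_sech.mono' (continuous_sech.pow n).aestronglyMeasurable ?_
  refine Eventually.of_forall fun s => ?_
  rw [Real.norm_of_nonneg (pow_nonneg (sech_nonneg s) n)]
  exact sech_pow_le hn s

lemma ofReal_sechFourier {n : ℕ} (hn : n ≠ 0) (ξ : ℝ) :
    sechFourier n ξ
      = (∫ s : ℝ, ((1 / cosh s : ℝ) : ℂ) ^ n * Complex.exp (ξ * s * Complex.I)).re := by
  rw [sechFourier, ← RCLike.re_eq_complex_re, ← integral_re]
  · congr 1
    ext s
    rw [RCLike.re_eq_complex_re, ← Complex.ofReal_pow, Complex.re_ofReal_mul,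
      show (ξ * s * Complex.I : ℂ) = ((ξ * s : ℝ) : ℂ) * Complex.I by push_cast; ring,
      Complex.exp_ofReal_mul_I_re]
  · refine (integrable_sech_pow hn).mono' ?_ (Eventually.of_forall fun s => ?_)
    · exact (((Complex.continuous_ofReal.comp continuous_sech).pow n).mul
        (by fun_prop)).aestronglyMeasurable
    · rw [norm_mul, show (ξ * s * Complex.I : ℂ) = ((ξ * s : ℝ) : ℂ) * Complex.I by push_cast; ring,
        Complex.norm_exp_ofReal_mul_I, ← Complex.ofReal_pow, Complex.norm_real,
        Real.norm_of_nonneg (pow_nonneg (sech_nonneg s) n), mul_one]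

lemma sechFourier_eq_Gamma {n : ℕ} (hn : n ≠ 0) (ξ : ℝ) :
    sechFourier n ξ = (Complex.Gamma ((n + ξ * Complex.I) / 2)
      * Complex.Gamma ((n - ξ * Complex.I) / 2) / Complex.Gamma n * (2 ^ n / 2)).re := by
  have hn' : (0 : ℝ) < n := by positivity
  rw [ofReal_sechFourier hn, Complex.Gamma_mul_Gamma_eq_betaIntegral (by simpa using hn')
    (by simpa using hn'), betaIntegral_eq_integral_sech,
    show (n + ξ * Complex.I) / 2 + (n - ξ * Complex.I) / 2 = (n : ℂ) by ring]
  have h : Complex.Gamma n ≠ 0 := Complex.Gamma_ne_zero_of_re_pos (by simpa using hn')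
  congr 1
  generalize (∫ s : ℝ, ((1 / cosh s : ℝ) : ℂ) ^ n * Complex.exp (ξ * s * Complex.I)) = J
  field_simp

lemma sechFourier_add_two {n : ℕ} (hn : n ≠ 0) (ξ : ℝ) :
    sechFourier (n + 2) ξ = ((n : ℝ) ^ 2 + ξ ^ 2) / (n * (n + 1)) * sechFourier n ξ := by
  have hn' : (0 : ℝ) < n := by positivity
  have hnC : (n : ℂ) ≠ 0 := by exact_mod_cast hn
  have hnC1 : (n : ℂ) + 1 ≠ 0 := by exact_mod_cast n.succ_ne_zero
  rw [sechFourier_eq_Gamma (by lia), sechFourier_eq_Gamma hn, ← Complex.re_ofReal_mul]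
  congr 1
  have e1 : (((n + 2 : ℕ) : ℂ) + ξ * Complex.I) / 2 = (n + ξ * Complex.I) / 2 + 1 := by
    push_cast; ring
  have e2 : (((n + 2 : ℕ) : ℂ) - ξ * Complex.I) / 2 = (n - ξ * Complex.I) / 2 + 1 := by
    push_cast; ring
  have e3 : ((n + 2 : ℕ) : ℂ) = (n : ℂ) + 1 + 1 := by push_cast; ring
  have z1 : (n + ξ * Complex.I) / 2 ≠ 0 := fun h => by
    have := congrArg Complex.re h; simp at this; exact hn this
  have z2 : (n - ξ * Complex.I) / 2 ≠ 0 := fun h => by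
    have := congrArg Complex.re h; simp at this; exact hn this
  have h : Complex.Gamma n ≠ 0 := Complex.Gamma_ne_zero_of_re_pos (by simpa using hn')
  rw [e1, e2, e3, Complex.Gamma_add_one _ z1, Complex.Gamma_add_one _ z2,
    Complex.Gamma_add_one _ hnC1, Complex.Gamma_add_one _ hnC]
  push_cast
  field_simp
  ring_nf
  rw [Complex.I_sq]
  ring

lemma sechFourier_one (ξ : ℝ) : sechFourier 1 ξ = π / cosh (π * ξ / 2) := by
  rw [sechFourier_eq_Gamma one_ne_zero]
  have := Complex.Gamma_mul_Gamma_one_sub ((1 + ξ * Complex.I) / 2)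
  rw [show 1 - (1 + ξ * Complex.I) / 2 = (1 - ξ * Complex.I) / 2 by ring,
    show (π : ℂ) * ((1 + ξ * Complex.I) / 2) = ((π * ξ / 2 : ℝ) : ℂ) * Complex.I + π / 2 by
      push_cast; ring, Complex.sin_add_pi_div_two, Complex.cos_mul_I] at this
  push_cast
  rw [this]
  simp only [Complex.Gamma_one, pow_one, div_one, ne_eq, OfNat.ofNat_ne_zero, not_false_eq_true,
    div_self, mul_one]
  rw [← Complex.ofReal_cosh, ← Complex.ofReal_div, Complex.ofReal_re]

lemma sechFourier_two {ξ : ℝ} (hξ : ξ ≠ 0) : sechFourier 2 ξ = π * ξ / sinh (π * ξ / 2) := by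
  rw [sechFourier_eq_Gamma two_ne_zero]
  have hw : (ξ * Complex.I / 2 : ℂ) ≠ 0 := by simp [hξ]
  have := Complex.Gamma_mul_Gamma_one_sub (ξ * Complex.I / 2)
  rw [show (π : ℂ) * (ξ * Complex.I / 2) = ((π * ξ / 2 : ℝ) : ℂ) * Complex.I by
      push_cast; ring, Complex.sin_mul_I] at this
  have hs : Complex.sinh ((π * ξ / 2 : ℝ) : ℂ) ≠ 0 := by
    rw [← Complex.ofReal_sinh]
    have : sinh (π * ξ / 2) ≠ 0 := by
      rw [Ne, Real.sinh_eq_zero]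
      have := pi_pos
      positivity
    exact_mod_cast this
  rw [show (((2 : ℕ) : ℂ) + ξ * Complex.I) / 2 = ξ * Complex.I / 2 + 1 by push_cast; ring,
    show (((2 : ℕ) : ℂ) - ξ * Complex.I) / 2 = 1 - ξ * Complex.I / 2 by push_cast; ring,
    Complex.Gamma_add_one _ hw, mul_assoc (ξ * Complex.I / 2 : ℂ), this]
  rw [show ((2 : ℕ) : ℂ) = 1 + 1 by norm_num, Complex.Gamma_add_one _ one_ne_zero,
    Complex.Gamma_one, ← Complex.ofReal_re (π * ξ / sinh (π * ξ / 2))]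
  congr 1
  have hI := Complex.I_ne_zero
  rw [show ((π * ξ / sinh (π * ξ / 2) : ℝ) : ℂ) = π * ξ / Complex.sinh ((π * ξ / 2 : ℝ) : ℂ) by
    push_cast; rfl]
  generalize Complex.sinh ((π * ξ / 2 : ℝ) : ℂ) = S at hs
  field_simp

lemma sechFourier_pos (ξ : ℝ) (hξ : 0 < ξ) (n : ℕ) : 0 < sechFourier (n + 1) ξ := by
  induction n using Nat.twoStepInduction with
  | zero => rw [sechFourier_one]; have := cosh_pos (π * ξ / 2); positivity
  | one =>
    rw [sechFourier_two hξ.ne']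
    have : 0 < sinh (π * ξ / 2) := Real.sinh_pos_iff.2 (by positivity)
    positivity
  | more n ih _ =>
    rw [show n + 2 + 1 = (n + 1) + 2 by ring, sechFourier_add_two n.succ_ne_zero]
    positivity

lemma continuous_tanh : Continuous tanh := by
  have : tanh = fun s => sinh s / cosh s := by
    ext s; exact Real.tanh_eq_sinh_div_cosh s
  rw [this]
  exact Real.continuous_sinh.div Real.continuous_cosh fun s => (cosh_pos s).ne'

/-- Integration by parts against `(sechⁿ)' = -n sechⁿ tanh`. -/
lemma integral_sech_pow_mul_tanh_mul_sin {n : ℕ} (hn : n ≠ 0) (ξ : ℝ) :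
    n * ∫ s : ℝ, (1 / cosh s) ^ n * tanh s * sin (ξ * s) = ξ * sechFourier n ξ := by
  have hder : ∀ s : ℝ, HasDerivAt (fun s : ℝ => (1 / cosh s) ^ n)
      (-(n * ((1 / cosh s) ^ n * tanh s))) s := by
    intro s
    have h := ((hasDerivAt_const s (1 : ℝ)).div (Real.hasDerivAt_cosh s) (cosh_pos s).ne').pow n
    refine h.congr_deriv ?_
    obtain ⟨k, rfl⟩ := Nat.exists_eq_succ_of_ne_zero hn
    have := cosh_pos s
    simp only [Nat.succ_eq_add_one, Nat.add_sub_cancel, Pi.div_apply, Real.tanh_eq_sinh_div_cosh]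
    generalize hS : sinh s = S
    generalize hR : cosh s = R at this
    have hpow : (1 / R) ^ (k + 1) = (1 / R) ^ k * (1 / R) := pow_succ _ _
    rw [hpow]
    generalize (1 / R) ^ k = T
    field_simp
    ring
  have hsin : ∀ s : ℝ, HasDerivAt (fun s : ℝ => sin (ξ * s)) (ξ * cos (ξ * s)) s := by
    intro s
    have h := ((hasDerivAt_id s).const_mul ξ).sin
    refine h.congr_deriv ?_
    simp [mul_comm]
  have bd : ∀ g : ℝ → ℝ, Continuous g → (∃ C, ∀ s, |g s| ≤ C) →
      Integrable fun s => (1 / cosh s) ^ n * g s := by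
    rintro g hg ⟨C, hC⟩
    exact (integrable_sech_pow hn).mul_bdd (c := C) hg.aestronglyMeasurable
      (Eventually.of_forall hC)
  have ht : ∀ s : ℝ, |tanh s| ≤ 1 := fun s => (abs_tanh_lt_one s).le
  have i1 : Integrable fun s : ℝ => (1 / cosh s) ^ n * (ξ * cos (ξ * s)) :=
    bd _ (by fun_prop) ⟨|ξ|, fun s => by
      rw [abs_mul]; exact mul_le_of_le_one_right (abs_nonneg _) (abs_cos_le_one _)⟩
  have i2 : Integrable fun s : ℝ => (1 / cosh s) ^ n * (tanh s * sin (ξ * s)) :=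
    bd _ (continuous_tanh.mul (by fun_prop)) ⟨1, fun s => by
      rw [abs_mul]
      exact mul_le_one₀ (ht s) (abs_nonneg _) (abs_sin_le_one _)⟩
  have i3 : Integrable fun s : ℝ => (1 / cosh s) ^ n * sin (ξ * s) :=
    bd _ (by fun_prop) ⟨1, fun s => abs_sin_le_one _⟩
  have key := integral_mul_deriv_eq_deriv_mul_of_integrable (fun s _ => hder s)
    (fun s _ => hsin s) i1
    (by
      refine (i2.const_mul (-(n : ℝ))).congr (Eventually.of_forall fun s => ?_)
      simp only [Pi.mul_apply]; ring) i3
  rw [sechFourier, ← integral_const_mul, ← integral_const_mul, ← integral_neg] at *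
  rw [show (∫ s : ℝ, ξ * ((1 / cosh s) ^ n * cos (ξ * s)))
      = ∫ s : ℝ, (1 / cosh s) ^ n * (ξ * cos (ξ * s)) by congr 1; ext s; ring, key]
  congr 1; ext s; ring

/-! ### Fourier integrals of cosine powers and of the Poisson kernel -/

/-- The Fourier integral `∫₀^{2π} cosⁿ ψ cos (m ψ) dψ`. -/
noncomputable def cosPowFourier (n : ℕ) (m : ℤ) : ℝ :=
  ∫ ψ in (0 : ℝ)..(2 * π), cos ψ ^ n * cos (m * ψ)

lemma cosPowFourier_zero_of_ne {m : ℤ} (hm : m ≠ 0) : cosPowFourier 0 m = 0 := by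
  have hm' : (m : ℝ) ≠ 0 := by exact_mod_cast hm
  simp only [cosPowFourier, pow_zero, one_mul]
  rw [intervalIntegral.integral_comp_mul_left (fun x => cos x) hm', integral_cos]
  have : sin ((m : ℝ) * (2 * π)) = 0 := by
    rw [show (m : ℝ) * (2 * π) = ((2 * m : ℤ) : ℝ) * π by push_cast; ring]
    exact Real.sin_int_mul_pi _
  simp [this]

lemma cosPowFourier_zero_zero : cosPowFourier 0 0 = 2 * π := by
  simp [cosPowFourier]

lemma cosPowFourier_succ (n : ℕ) (m : ℤ) :
    cosPowFourier (n + 1) m = (cosPowFourier n (m + 1) + cosPowFourier n (m - 1)) / 2 := by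
  simp only [cosPowFourier]
  rw [← intervalIntegral.integral_add (Continuous.intervalIntegrable (by fun_prop) _ _)
    (Continuous.intervalIntegrable (by fun_prop) _ _), ← intervalIntegral.integral_div]
  congr 1
  ext ψ
  push_cast
  rw [add_mul, sub_mul, one_mul, cos_add, cos_sub]
  ring

lemma cosPowFourier_parity (n : ℕ) (k : ℤ) : cosPowFourier n (n + 1 + 2 * k) = 0 := by
  induction n generalizing k with
  | zero => exact cosPowFourier_zero_of_ne (by push_cast; lia)
  | succ n ih =>
    rw [cosPowFourier_succ]
    have h1 := ih (k + 1)
    have h2 := ih k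
    rw [show ((n + 1 : ℕ) : ℤ) + 1 + 2 * k + 1 = n + 1 + 2 * (k + 1) by push_cast; ring, h1,
      show ((n + 1 : ℕ) : ℤ) + 1 + 2 * k - 1 = n + 1 + 2 * k by push_cast; ring, h2]
    simp

lemma cosPowFourier_of_lt (n : ℕ) (m : ℤ) (h : (n : ℤ) < m) : cosPowFourier n m = 0 := by
  induction n generalizing m with
  | zero => exact cosPowFourier_zero_of_ne (by push_cast at h; lia)
  | succ n ih =>
    push_cast at h
    rw [cosPowFourier_succ, ih _ (by lia), ih _ (by lia)]
    simp

lemma cosPowFourier_eq_choose (n j : ℕ) :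
    cosPowFourier n (n - 2 * j) = 2 * π * (n.choose j / 2 ^ n) := by
  induction n generalizing j with
  | zero =>
    cases j with
    | zero => simpa using cosPowFourier_zero_zero
    | succ j => rw [cosPowFourier_zero_of_ne (by push_cast; lia)]; simp
  | succ n ih =>
    rw [cosPowFourier_succ, show ((n + 1 : ℕ) : ℤ) - 2 * j - 1 = n - 2 * j by push_cast; ring, ih]
    cases j with
    | zero =>
      rw [cosPowFourier_of_lt _ _ (by push_cast; lia)]
      simp [pow_succ]
      ring
    | succ j =>
      rw [show ((n + 1 : ℕ) : ℤ) - 2 * (j + 1 : ℕ) + 1 = n - 2 * j by push_cast; ring, ih,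
        Nat.choose_succ_succ, pow_succ]
      push_cast
      ring

/-- The binomial evaluation of `∫ cosⁿ ψ cos (m ψ) dψ` for `n = m + 2 j`. -/
lemma cosPowFourier_add_two_mul (m j : ℕ) :
    cosPowFourier (m + 2 * j) m = 2 * π * ((m + 2 * j).choose j / 2 ^ (m + 2 * j)) := by
  rw [← cosPowFourier_eq_choose]
  congr 1
  push_cast
  ring

lemma cosPowFourier_eq_zero (m n : ℕ) (h : n ∉ Set.range fun j : ℕ => m + 2 * j) :
    cosPowFourier n m = 0 := by
  rcases lt_or_ge n m with h1 | h1
  · exact cosPowFourier_of_lt _ _ (by exact_mod_cast h1)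
  · rcases Int.emod_two_eq_zero_or_one ((n : ℤ) - m) with h2 | h2
    · exact absurd ⟨(n - m) / 2, by simp only; lia⟩ h
    · have := cosPowFourier_parity n ((m - n - 1) / 2)
      rwa [show (n : ℤ) + 1 + 2 * ((m - n - 1) / 2) = m by lia] at this

section PoissonKernel

variable {c : ℝ}

/-- The Fourier integral `∫₀^{2π} cos (k θ) / (c - cos θ) dθ`. -/
noncomputable def poissonFourier (c : ℝ) (k : ℤ) : ℝ :=
  ∫ θ in (0 : ℝ)..(2 * π), 1 / (c - cos θ) * cos (k * θ)

lemma sub_cos_pos (hc : 1 < c) (θ : ℝ) : 0 < c - cos θ := by linarith [cos_le_one θ]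

lemma continuous_one_div_sub_cos (hc : 1 < c) : Continuous fun θ => 1 / (c - cos θ) :=
  continuous_const.div (by fun_prop) fun θ => (sub_cos_pos hc θ).ne'

lemma abs_one_div_sub_cos_le (hc : 1 < c) (θ : ℝ) : |1 / (c - cos θ)| ≤ 1 / (c - 1) := by
  rw [abs_of_pos (one_div_pos.2 (sub_cos_pos hc θ))]
  exact one_div_le_one_div_of_le (by linarith) (by linarith [cos_le_one θ])

lemma poissonFourier_zero_pos (hc : 1 < c) : 0 < poissonFourier c 0 := by
  refine intervalIntegral.intervalIntegral_pos_of_pos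
    (((continuous_one_div_sub_cos hc).mul (by fun_prop)).intervalIntegrable _ _)
    (fun θ => ?_) (by positivity)
  have := sub_cos_pos hc θ
  simpa using this

lemma abs_poissonFourier_le (hc : 1 < c) (k : ℤ) :
    |poissonFourier c k| ≤ 1 / (c - 1) * (2 * π) := by
  have := intervalIntegral.norm_integral_le_of_norm_le_const (a := 0) (b := 2 * π)
    (C := 1 / (c - 1))
    (f := fun θ => 1 / (c - cos θ) * cos (k * θ)) (fun θ _ => by
      rw [norm_mul]
      refine (mul_le_of_le_one_right (norm_nonneg _) (abs_cos_le_one _)).trans ?_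
      exact abs_one_div_sub_cos_le hc θ)
  rwa [sub_zero, abs_of_pos (by positivity : 0 < 2 * π)] at this

lemma poissonFourier_recursion (hc : 1 < c) {k : ℤ} (hk : k ≠ 0) :
    poissonFourier c (k + 1) = 2 * c * poissonFourier c k - poissonFourier c (k - 1) := by
  have h0 := cosPowFourier_zero_of_ne hk
  have hi : ∀ l : ℤ, IntervalIntegrable (fun θ => 1 / (c - cos θ) * cos (l * θ)) volume 0 (2 * π) :=
    fun l => ((continuous_one_div_sub_cos hc).mul (by fun_prop)).intervalIntegrable _ _
  have : 2 * cosPowFourier 0 k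
      = 2 * c * poissonFourier c k - poissonFourier c (k - 1) - poissonFourier c (k + 1) := by
    simp only [cosPowFourier, poissonFourier]
    rw [← intervalIntegral.integral_const_mul, ← intervalIntegral.integral_const_mul,
      ← intervalIntegral.integral_sub ((hi k).const_mul _) (hi _),
      ← intervalIntegral.integral_sub (((hi k).const_mul _).sub (hi _)) (hi _)]
    congr 1
    ext θ
    have := (sub_cos_pos hc θ).ne'
    push_cast
    rw [add_mul, sub_mul, one_mul, cos_add, cos_sub]
    field_simp
    ring
  rw [h0] at this
  linarith

lemma poissonFourier_neg (k : ℤ) : poissonFourier c (-k) = poissonFourier c k := by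
  simp only [poissonFourier]
  congr 1
  ext θ
  push_cast
  rw [neg_mul, cos_neg]

lemma one_lt_rho (hc : 1 < c) : 1 < rho c := by
  have := Real.sqrt_nonneg (c ^ 2 - 1)
  rw [rho]; linarith

lemma rho_add_inv (hc : 1 < c) : rho c + (rho c)⁻¹ = 2 * c := by
  have h1 := one_lt_rho hc
  have h2 : √(c ^ 2 - 1) ^ 2 = c ^ 2 - 1 := Real.sq_sqrt (by nlinarith)
  have : (rho c)⁻¹ = c - √(c ^ 2 - 1) := by
    rw [inv_eq_iff_eq_inv, eq_comm, inv_eq_iff_eq_inv, eq_comm, inv_eq_of_mul_eq_one_right]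
    rw [rho]; nlinarith
  rw [this, rho]; ring

/-- The Fourier coefficients of `1 / (c - cos θ)` decay geometrically: they solve a second order
recursion whose other solutions are unbounded. -/
lemma poissonFourier_natCast (hc : 1 < c) (k : ℕ) :
    poissonFourier c k = poissonFourier c 0 * (rho c)⁻¹ ^ k := by
  have hρ := one_lt_rho hc
  have hρ_pos : 0 < rho c := by linarith
  have hρ0 : rho c ≠ 0 := hρ_pos.ne'
  set q := (rho c)⁻¹ with hq
  have hrel := rho_add_inv hc
  have hstep : ∀ k : ℕ, poissonFourier c ((k : ℤ) + 1) - q * poissonFourier c k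
      = rho c ^ k * (poissonFourier c 1 - q * poissonFourier c 0) := by
    intro k
    induction k with
    | zero => simp
    | succ k ih =>
      have := poissonFourier_recursion hc (k := (k : ℤ) + 1) (by lia)
      push_cast
      rw [this, pow_succ, ← hrel, ← hq, show (k : ℤ) + 1 - 1 = k by ring]
      have h1 : rho c * q = 1 := mul_inv_cancel₀ hρ0
      linear_combination (rho c) * ih + poissonFourier c k * h1
  have hzero : poissonFourier c 1 - q * poissonFourier c 0 = 0 := by
    by_contra hne
    set D := poissonFourier c 1 - q * poissonFourier c 0
    set B := 1 / (c - 1) * (2 * π)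
    have hbound : ∀ k : ℕ, rho c ^ k ≤ (B + q * B) / |D| := by
      intro k
      rw [le_div_iff₀ (abs_pos.2 hne)]
      have hq0 : 0 ≤ q := by positivity
      calc rho c ^ k * |D| = |rho c ^ k * D| := by rw [abs_mul, abs_of_pos (pow_pos hρ_pos k)]
        _ = |poissonFourier c ((k : ℤ) + 1) - q * poissonFourier c k| := by rw [hstep]
        _ ≤ |poissonFourier c ((k : ℤ) + 1)| + |q * poissonFourier c k| := abs_sub _ _
        _ ≤ B + q * B := by
          rw [abs_mul, abs_of_nonneg hq0]
          gcongr
          · exact abs_poissonFourier_le hc _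
          · exact abs_poissonFourier_le hc _
    obtain ⟨k, hk⟩ := pow_unbounded_of_one_lt ((B + q * B) / |D|) hρ
    exact absurd (hbound k) (not_le.2 hk)
  induction k with
  | zero => simp
  | succ k ih =>
    have := hstep k
    rw [hzero, mul_zero, sub_eq_zero] at this
    push_cast
    rw [this, ih, pow_succ]
    ring

lemma poissonFourier_eq (hc : 1 < c) (k : ℤ) :
    poissonFourier c k = poissonFourier c 0 * (rho c)⁻¹ ^ k.natAbs := by
  rcases Int.natAbs_eq k with h | h
  · conv_lhs => rw [h]
    exact poissonFourier_natCast hc _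
  · conv_lhs => rw [h, poissonFourier_neg]
    exact poissonFourier_natCast hc _

end PoissonKernel

/-! ### Fourier coefficients of an integral along the flow -/

lemma integral_eq_zero_of_periodic_of_odd {f : ℝ → ℝ} (hp : Function.Periodic f (2 * π))
    (ho : ∀ x, f (-x) = -f x) : ∫ x in (0 : ℝ)..(2 * π), f x = 0 := by
  have h := intervalIntegral.integral_comp_sub_left f (2 * π) (a := 0) (b := 2 * π)
  have h2 : (fun x => f (2 * π - x)) = fun x => -f x := by
    ext x
    rw [← ho, ← hp (-x)]
    congr 1; ring
  rw [h2, sub_self, sub_zero, intervalIntegral.integral_neg] at h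
  linarith

lemma cos_int_mul_add_two_pi (m : ℤ) (θ : ℝ) : cos (m * (θ + 2 * π)) = cos (m * θ) := by
  rw [mul_add, Real.cos_add_int_mul_two_pi]

lemma sin_int_mul_add_two_pi (m : ℤ) (θ : ℝ) : sin (m * (θ + 2 * π)) = sin (m * θ) := by
  rw [mul_add, Real.sin_add_int_mul_two_pi]

lemma periodic_sin_int_mul_sub (m : ℤ) (τ : ℝ) :
    Function.Periodic (fun ψ => sin (m * ψ - τ)) (2 * π) := by
  intro θ
  simp only [sin_sub]
  rw [sin_int_mul_add_two_pi, cos_int_mul_add_two_pi]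

lemma integral_one_div_sub_cos_mul_sin {c : ℝ} (hc : 1 < c) (m : ℤ) (τ α : ℝ) :
    ∫ θ in (0 : ℝ)..(2 * π), 1 / (c - cos (τ + θ)) * sin (α - m * θ)
      = poissonFourier c m * sin (α + m * τ) := by
  have hper : Function.Periodic (fun θ => 1 / (c - cos θ) * sin (α + m * τ - m * θ)) (2 * π) := by
    intro θ
    simp only [sin_sub, cos_add_two_pi]
    rw [sin_int_mul_add_two_pi, cos_int_mul_add_two_pi]
  have h1 := intervalIntegral.integral_comp_add_left
    (fun θ => 1 / (c - cos θ) * sin (α + m * τ - m * θ)) τ (a := 0) (b := 2 * π)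
  have h2 := hper.intervalIntegral_add_eq τ 0
  rw [zero_add] at h2
  rw [add_zero, h2] at h1
  have h3 : ∫ θ in (0 : ℝ)..(2 * π), 1 / (c - cos θ) * sin (m * θ) = 0 := by
    refine integral_eq_zero_of_periodic_of_odd (fun θ => ?_) fun θ => ?_
    · simp only [cos_add_two_pi]
      rw [sin_int_mul_add_two_pi]
    · rw [cos_neg, mul_neg, sin_neg, mul_neg]
  have hcont := continuous_one_div_sub_cos hc
  calc _ = ∫ θ in (0 : ℝ)..(2 * π), 1 / (c - cos (τ + θ)) * sin (α + m * τ - m * (τ + θ)) := by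
        congr 1; ext θ; congr 2; ring
    _ = ∫ θ in (0 : ℝ)..(2 * π), 1 / (c - cos θ) * sin (α + m * τ - m * θ) := h1
    _ = ∫ θ in (0 : ℝ)..(2 * π), (sin (α + m * τ) * (1 / (c - cos θ) * cos (m * θ))
          - cos (α + m * τ) * (1 / (c - cos θ) * sin (m * θ))) := by
        congr 1; ext θ; rw [sin_sub (α + m * τ)]; ring
    _ = _ := by
        have i1 : Continuous fun θ => sin (α + m * τ) * (1 / (c - cos θ) * cos (m * θ)) :=
          continuous_const.mul (hcont.mul (by fun_prop))
        have i2 : Continuous fun θ => cos (α + m * τ) * (1 / (c - cos θ) * sin (m * θ)) :=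
          continuous_const.mul (hcont.mul (by fun_prop))
        rw [intervalIntegral.integral_sub (i1.intervalIntegrable _ _) (i2.intervalIntegrable _ _),
          intervalIntegral.integral_const_mul, intervalIntegral.integral_const_mul, h3,
          poissonFourier]
        ring

lemma integrable_prod_of_le {F : ℝ × ℝ → ℝ} (hF : Continuous F) {w : ℝ → ℝ} (hw : Integrable w)
    {C : ℝ} (hb : ∀ x, |F x| ≤ C * w x.2) :
    Integrable F ((volume.restrict (Set.uIoc (0 : ℝ) (2 * π))).prod volume) := by
  have : Integrable (fun _ : ℝ => C) (volume.restrict (Set.uIoc (0 : ℝ) (2 * π))) := by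
    rw [Set.uIoc_of_le (by positivity)]
    exact integrable_const _
  exact (this.mul_prod hw).mono' hF.aestronglyMeasurable (Eventually.of_forall hb)

/-- Fubini and the shift of both phases along the flow reduce the double Fourier coefficient of an
integral over time to a single oscillatory integral with frequency `m₁ - γ m₂`. -/
lemma integral_integral_integral_eq {c : ℝ} (hc : 1 < c) {g : ℝ → ℝ → ℝ}
    (hg : Continuous (Function.uncurry g)) (hper : ∀ t, Function.Periodic (g t) (2 * π))
    {w : ℝ → ℝ} (hw : Integrable w) (hb : ∀ t ψ, |g t ψ| ≤ w t) (γ : ℝ) (m₁ m₂ : ℤ) :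
    ∫ ψ₀ in (0 : ℝ)..(2 * π), ∫ θ₀ in (0 : ℝ)..(2 * π),
        (∫ t, g t (t + ψ₀) * (1 / (c - cos (γ * t + θ₀)))) * sin (m₁ * ψ₀ - m₂ * θ₀)
      = poissonFourier c m₂ * ∫ t, ∫ ψ in (0 : ℝ)..(2 * π),
          g t ψ * sin (m₁ * ψ - (m₁ - γ * m₂) * t) := by
  have hcont := continuous_one_div_sub_cos hc
  have hg' : ∀ {X : Type} [TopologicalSpace X] {a b : X → ℝ}, Continuous a → Continuous b →
      Continuous fun x => g (a x) (b x) := fun ha hb' => hg.comp (ha.prodMk hb')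
  have hc1 : 0 < 1 / (c - 1) := one_div_pos.2 (by linarith)
  have hw0 : ∀ t, 0 ≤ w t := fun t => (abs_nonneg _).trans (hb t 0)
  have step1 : ∀ ψ₀ : ℝ, ∫ θ₀ in (0 : ℝ)..(2 * π),
      (∫ t, g t (t + ψ₀) * (1 / (c - cos (γ * t + θ₀)))) * sin (m₁ * ψ₀ - m₂ * θ₀)
      = ∫ t, g t (t + ψ₀) * (poissonFourier c m₂ * sin (m₁ * ψ₀ + m₂ * (γ * t))) := by
    intro ψ₀
    simp_rw [← integral_mul_const]
    rw [intervalIntegral_integral_swap]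
    · congr 1
      ext t
      rw [← integral_one_div_sub_cos_mul_sin hc, ← intervalIntegral.integral_const_mul]
      congr 1; ext θ; ring
    · refine integrable_prod_of_le (C := 1 / (c - 1)) ?_ hw ?_
      · exact ((hg' (by fun_prop) (by fun_prop)).mul (hcont.comp (by fun_prop))).mul (by fun_prop)
      · rintro ⟨θ, t⟩
        simp only [Function.uncurry_apply_pair]
        rw [abs_mul, abs_mul]
        calc _ ≤ w t * (1 / (c - 1)) * 1 := by
              gcongr
              · exact mul_nonneg (hw0 t) hc1.le
              · exact hw0 t
              · exact hb _ _
              · exact abs_one_div_sub_cos_le hc _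
              · exact abs_sin_le_one _
          _ = _ := by ring
  simp_rw [step1]
  rw [intervalIntegral_integral_swap]
  · rw [← integral_const_mul]
    congr 1
    ext t
    have hper' : Function.Periodic (fun ψ => g t ψ * sin (m₁ * ψ - (m₁ - γ * m₂) * t)) (2 * π) :=
      (hper t).mul (periodic_sin_int_mul_sub m₁ _)
    have h1 := intervalIntegral.integral_comp_add_left
      (fun ψ => g t ψ * sin (m₁ * ψ - (m₁ - γ * m₂) * t)) t (a := 0) (b := 2 * π)
    have h2 := hper'.intervalIntegral_add_eq t 0
    rw [zero_add] at h2
    rw [add_zero, h2] at h1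
    rw [← h1, ← intervalIntegral.integral_const_mul]
    congr 1
    ext ψ
    rw [show m₁ * (t + ψ) - (m₁ - γ * m₂) * t = m₁ * ψ + m₂ * (γ * t) by ring]
    ring
  · refine integrable_prod_of_le (C := |poissonFourier c m₂|) ?_ hw ?_
    · exact (hg' (by fun_prop) (by fun_prop)).mul (by fun_prop)
    · rintro ⟨θ, t⟩
      simp only [Function.uncurry_apply_pair]
      rw [abs_mul, abs_mul]
      calc _ ≤ w t * (|poissonFourier c m₂| * 1) := by
            gcongr
            · exact hw0 t
            · exact hb _ _
            · exact abs_sin_le_one _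
        _ = _ := by ring

/-- The same coefficient for a kernel given as a series with separated variables. -/
lemma hasSum_integral_integral_integral {c : ℝ} (hc : 1 < c) {g : ℝ → ℝ → ℝ}
    (hg : Continuous (Function.uncurry g)) {a : ℕ → ℝ → ℝ} {s : ℕ → ℝ → ℝ} {b : ℕ → ℝ} {v : ℝ → ℝ}
    (hs : ∀ k, Continuous (s k)) (ha : ∀ k, Continuous (a k)) (hsb : ∀ k ψ, |s k ψ| ≤ 1)
    (hab : ∀ k t, |a k t| ≤ b k * v t) (hb : Summable b) (hv : Integrable v)
    (hper : ∀ k, Function.Periodic (s k) (2 * π))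
    (hsum : ∀ t ψ, HasSum (fun k => a k t * s k ψ) (g t ψ)) (γ : ℝ) (m₁ m₂ : ℤ) :
    HasSum (fun k => poissonFourier c m₂ * ∫ t, a k t
        * (cos ((m₁ - γ * m₂) * t) * (∫ ψ in (0 : ℝ)..(2 * π), s k ψ * sin (m₁ * ψ))
          - sin ((m₁ - γ * m₂) * t) * (∫ ψ in (0 : ℝ)..(2 * π), s k ψ * cos (m₁ * ψ))))
      (∫ ψ₀ in (0 : ℝ)..(2 * π), ∫ θ₀ in (0 : ℝ)..(2 * π),
        (∫ t, g t (t + ψ₀) * (1 / (c - cos (γ * t + θ₀)))) * sin (m₁ * ψ₀ - m₂ * θ₀)) := by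
  have hper' : ∀ t, Function.Periodic (g t) (2 * π) := fun t ψ =>
    (hsum t (ψ + 2 * π)).unique (by simpa only [(hper _) ψ] using hsum t ψ)
  have habs : ∀ k t ψ, |a k t * s k ψ| ≤ b k * v t := fun k t ψ => by
    rw [abs_mul]
    exact (mul_le_of_le_one_right (abs_nonneg _) (hsb k ψ)).trans (hab k t)
  have hgb : ∀ t ψ, |g t ψ| ≤ (∑' k, b k) * v t := fun t ψ => by
    have h1 : HasSum (fun k => b k * v t) ((∑' k, b k) * v t) := hb.hasSum.mul_right _
    exact (hsum t ψ).norm_le_of_bounded h1 (habs · t ψ)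
  rw [integral_integral_integral_eq hc hg hper' (hv.const_mul _) hgb]
  refine HasSum.mul_left _ ?_
  set ω := (m₁ : ℝ) - γ * m₂
  have hin : ∀ k t, ∫ ψ in (0 : ℝ)..(2 * π), a k t * s k ψ * sin (m₁ * ψ - ω * t)
      = a k t * (cos (ω * t) * (∫ ψ in (0 : ℝ)..(2 * π), s k ψ * sin (m₁ * ψ))
          - sin (ω * t) * (∫ ψ in (0 : ℝ)..(2 * π), s k ψ * cos (m₁ * ψ))) := by
    intro k t
    have hsk := hs k
    have i1 : Continuous fun ψ => cos (ω * t) * (s k ψ * sin (m₁ * ψ)) := by fun_prop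
    have i2 : Continuous fun ψ => sin (ω * t) * (s k ψ * cos (m₁ * ψ)) := by fun_prop
    rw [← intervalIntegral.integral_const_mul, ← intervalIntegral.integral_const_mul,
      ← intervalIntegral.integral_sub (i1.intervalIntegrable _ _) (i2.intervalIntegrable _ _),
      ← intervalIntegral.integral_const_mul]
    congr 1; ext ψ; rw [sin_sub]; ring
  simp_rw [← hin]
  have hbd : ∀ k t ψ, ‖a k t * s k ψ * sin (m₁ * ψ - ω * t)‖ ≤ b k * v t := fun k t ψ => by
    rw [norm_mul]
    exact (mul_le_of_le_one_right (abs_nonneg _) (abs_sin_le_one _)).trans (habs k t ψ)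
  refine hasSum_integral_of_dominated_convergence (fun k t => b k * v t * (2 * π)) ?_ ?_ ?_ ?_ ?_
  · intro k
    simp_rw [hin]
    exact ((ha k).mul (by fun_prop)).aestronglyMeasurable
  · intro k
    refine Eventually.of_forall fun t => ?_
    have := intervalIntegral.norm_integral_le_of_norm_le_const (a := 0) (b := 2 * π)
      (f := fun ψ => a k t * s k ψ * sin (m₁ * ψ - ω * t)) (fun ψ _ => hbd k t ψ)
    rwa [sub_zero, abs_of_pos (by positivity : 0 < 2 * π)] at this
  · exact Eventually.of_forall fun t => (hb.mul_right _).mul_right _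
  · simp_rw [tsum_mul_right]
    exact (hv.const_mul _).mul_const _
  · refine Eventually.of_forall fun t => ?_
    refine intervalIntegral.hasSum_integral_of_dominated_convergence (fun k _ => b k * v t)
      ?_ ?_ ?_ ?_ ?_
    · intro k
      exact ((continuous_const.mul (hs k)).mul (by fun_prop)).aestronglyMeasurable
    · exact fun k => Eventually.of_forall fun ψ _ => hbd k t ψ
    · exact Eventually.of_forall fun ψ _ => hb.mul_right _
    · exact intervalIntegrable_const
    · exact Eventually.of_forall fun ψ _ => (hsum t ψ).mul_right _

/-! ### The amplitudes as series -/

/-- The derivative of `y ↦ y⁵ / (d - y)`. -/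
noncomputable def profileDeriv (d y : ℝ) : ℝ := (5 * y ^ 4 * (d - y) + y ^ 5) / (d - y) ^ 2

lemma hasDerivAt_H₁ {c d θ y : ℝ} (hc : 1 < c) (hy : y ≠ d) (x₁ x₂ y₂ : ℝ) :
    HasDerivAt (fun u => H₁ c d θ x₁ x₂ u y₂) (profileDeriv d y * (1 / (c - cos θ))) y := by
  have h1 : d - y ≠ 0 := sub_ne_zero.2 hy.symm
  have h2 := (sub_cos_pos hc θ).ne'
  have h := ((hasDerivAt_id y).pow 5).div (((hasDerivAt_id y).const_sub d).mul_const (c - cos θ))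
    (mul_ne_zero h1 h2)
  refine h.congr_deriv ?_
  simp only [profileDeriv, id, Pi.pow_apply]
  field_simp
  push_cast
  ring

lemma poissonBracket_G₁_H₁ {c d θ y₁ : ℝ} (hc : 1 < c) (hy : y₁ ≠ d) (x₁ x₂ y₂ : ℝ) :
    poissonBracket G₁ (H₁ c d θ) x₁ x₂ y₁ y₂ = y₂ * (profileDeriv d y₁ * (1 / (c - cos θ))) := by
  have h : deriv (fun u => G₁ u x₂ y₁ y₂) x₁ = y₂ := by simp [G₁]
  rw [poissonBracket, (hasDerivAt_H₁ hc hy x₁ x₂ y₂).deriv, h]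
  simp [H₁]

lemma poissonBracket_G₂_H₁ {c d θ y₁ : ℝ} (hc : 1 < c) (hy : y₁ ≠ d) (x₁ x₂ y₂ : ℝ) :
    poissonBracket G₂ (H₁ c d θ) x₁ x₂ y₁ y₂ = x₁ * (profileDeriv d y₁ * (1 / (c - cos θ))) := by
  have h : deriv (fun u => G₂ u x₂ y₁ y₂) x₁ = x₁ := by
    simp [G₂]
  rw [poissonBracket, (hasDerivAt_H₁ hc hy x₁ x₂ y₂).deriv, h]
  simp [H₁]

lemma hasSum_profileDeriv {d y : ℝ} (hd : 0 < d) (hy : |y| < d) :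
    HasSum (fun k : ℕ => ((k : ℝ) + 5) / d ^ (k + 1) * y ^ (k + 4)) (profileDeriv d y) := by
  have hr : ‖y / d‖ < 1 := by
    rw [norm_div, Real.norm_eq_abs, Real.norm_of_nonneg hd.le]
    exact (div_lt_one hd).2 hy
  have hyd : d - y ≠ 0 := by linarith [(abs_lt.1 hy).2]
  have h := ((hasSum_coe_mul_geometric_of_norm_lt_one hr).add
    ((hasSum_geometric_of_norm_lt_one hr).mul_left 5)).mul_left (y ^ 4 / d)
  have e : profileDeriv d y = y ^ 4 / d * (y / d / (1 - y / d) ^ 2 + 5 * (1 - y / d)⁻¹) := by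
    have : 1 - y / d = (d - y) / d := by field_simp
    rw [this, profileDeriv]
    field_simp
    ring
  rw [e]
  refine h.congr_fun ?_
  intro k
  rw [div_pow, pow_succ, pow_add]
  field_simp

/-- The radius `R(t) = √2 sech (ν t)` of the homoclinic orbit in the `y`-plane. -/
noncomputable def orbitRadius (ν t : ℝ) : ℝ := √2 / cosh (ν * t)

lemma orbitRadius_eq (ν t : ℝ) : orbitRadius ν t = √2 * (1 / cosh (ν * t)) := by
  rw [orbitRadius]; ring

lemma continuous_orbitRadius (ν : ℝ) : Continuous (orbitRadius ν) :=
  continuous_const.div (Real.continuous_cosh.comp (by fun_prop)) fun t => (cosh_pos _).ne'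

lemma abs_orbitRadius_mul_cos_lt {d : ℝ} (hd : √2 < d) (ν t ψ : ℝ) :
    |orbitRadius ν t * cos ψ| < d := by
  refine lt_of_le_of_lt ?_ hd
  rw [abs_mul, orbitRadius_eq, abs_of_nonneg (mul_nonneg (Real.sqrt_nonneg 2) (sech_nonneg _))]
  calc _ ≤ √2 * 1 * 1 := by
        gcongr
        · exact sech_le_one _
        · exact abs_cos_le_one _
    _ = √2 := by ring

lemma orbitRadius_mul_cos_ne {d : ℝ} (hd : √2 < d) (ν t ψ : ℝ) :
    orbitRadius ν t * cos ψ ≠ d :=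
  ((le_abs_self _).trans_lt (abs_orbitRadius_mul_cos_lt hd ν t ψ)).ne

lemma alongHomoclinic_G₁ {c d : ℝ} (hc : 1 < c) (hd : √2 < d) (ν ψ₀ θ t : ℝ) :
    alongHomoclinic ν ψ₀ (poissonBracket G₁ (H₁ c d θ)) t
      = orbitRadius ν t * sin (t + ψ₀) * profileDeriv d (orbitRadius ν t * cos (t + ψ₀))
        * (1 / (c - cos θ)) := by
  have h := orbitRadius_mul_cos_ne hd ν t (t + ψ₀)
  rw [orbitRadius] at h
  rw [alongHomoclinic, poissonBracket_G₁_H₁ hc h, ← mul_assoc, orbitRadius]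

lemma alongHomoclinic_G₂ {c d : ℝ} (hc : 1 < c) (hd : √2 < d) (ν ψ₀ θ t : ℝ) :
    alongHomoclinic ν ψ₀ (poissonBracket G₂ (H₁ c d θ)) t
      = orbitRadius ν t * tanh (ν * t) * cos (t + ψ₀)
        * profileDeriv d (orbitRadius ν t * cos (t + ψ₀)) * (1 / (c - cos θ)) := by
  have h := orbitRadius_mul_cos_ne hd ν t (t + ψ₀)
  rw [orbitRadius] at h
  rw [alongHomoclinic, poissonBracket_G₂_H₁ hc h, ← mul_assoc, orbitRadius]

lemma continuous_profileDeriv_orbit {d : ℝ} (hd : √2 < d) (ν : ℝ) :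
    Continuous fun p : ℝ × ℝ => profileDeriv d (orbitRadius ν p.1 * cos p.2) := by
  have hR := continuous_orbitRadius ν
  have hy : Continuous fun p : ℝ × ℝ => orbitRadius ν p.1 * cos p.2 := by fun_prop
  refine Continuous.div (by fun_prop) (by fun_prop) fun p => pow_ne_zero 2 ?_
  exact sub_ne_zero.2 (orbitRadius_mul_cos_ne hd ν p.1 p.2).symm

lemma summable_coeff {d : ℝ} (hd : √2 < d) :
    Summable fun k : ℕ => ((k : ℝ) + 5) / d ^ (k + 1) * √2 ^ (k + 5) := by
  have h2 : (0 : ℝ) ≤ √2 := Real.sqrt_nonneg 2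
  have h := (hasSum_profileDeriv (h2.trans_lt hd) (by rwa [abs_of_nonneg h2])).summable.mul_right √2
  refine h.congr fun k => ?_
  rw [pow_succ √2 (k + 4)]; ring

/-- Expansion in powers of `y₁` of the double Fourier coefficient for a kernel
`τ(t) R(t) σ(ψ) f'(R(t) cos ψ)`, where `f(y) = y⁵ / (d - y)`. -/
lemma hasSum_coeff {c d ν : ℝ} (hc : 1 < c) (hd : √2 < d) (hν : 0 < ν) {τ σ : ℝ → ℝ}
    (hτ : Continuous τ) (hσ : Continuous σ) (hτb : ∀ t, |τ t| ≤ 1) (hσb : ∀ ψ, |σ ψ| ≤ 1)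
    (hσp : Function.Periodic σ (2 * π)) (γ : ℝ) (m₁ m₂ : ℤ) :
    HasSum (fun k : ℕ => poissonFourier c m₂ *
        ∫ t, ((k : ℝ) + 5) / d ^ (k + 1) * orbitRadius ν t ^ (k + 5) * τ t
          * (cos ((m₁ - γ * m₂) * t)
              * (∫ ψ in (0 : ℝ)..(2 * π), cos ψ ^ (k + 4) * σ ψ * sin (m₁ * ψ))
            - sin ((m₁ - γ * m₂) * t)
              * (∫ ψ in (0 : ℝ)..(2 * π), cos ψ ^ (k + 4) * σ ψ * cos (m₁ * ψ))))
      (∫ ψ₀ in (0 : ℝ)..(2 * π), ∫ θ₀ in (0 : ℝ)..(2 * π),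
        (∫ t, orbitRadius ν t * τ t * σ (t + ψ₀)
          * profileDeriv d (orbitRadius ν t * cos (t + ψ₀)) * (1 / (c - cos (γ * t + θ₀))))
          * sin (m₁ * ψ₀ - m₂ * θ₀)) := by
  have hR := continuous_orbitRadius ν
  have hd0 : 0 < d := (Real.sqrt_nonneg 2).trans_lt hd
  refine hasSum_integral_integral_integral hc
    (g := fun t ψ => orbitRadius ν t * τ t * σ ψ * profileDeriv d (orbitRadius ν t * cos ψ))
    (a := fun k t => ((k : ℝ) + 5) / d ^ (k + 1) * orbitRadius ν t ^ (k + 5) * τ t)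
    (s := fun k ψ => cos ψ ^ (k + 4) * σ ψ)
    (b := fun k : ℕ => ((k : ℝ) + 5) / d ^ (k + 1) * √2 ^ (k + 5))
    (v := fun t => 1 / cosh (ν * t)) ?_ ?_ ?_ ?_ ?_ (summable_coeff hd) ?_ ?_ ?_ γ m₁ m₂
  · have := continuous_profileDeriv_orbit hd ν
    simp only [Function.uncurry_def]
    fun_prop
  · intro k; fun_prop
  · intro k; fun_prop
  · intro k ψ
    rw [abs_mul, abs_pow]
    exact mul_le_one₀ (pow_le_one₀ (abs_nonneg _) (abs_cos_le_one _)) (abs_nonneg _) (hσb ψ)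
  · intro k t
    have h0 : 0 ≤ ((k : ℝ) + 5) / d ^ (k + 1) := by positivity
    rw [orbitRadius_eq, mul_pow, abs_mul, abs_of_nonneg (mul_nonneg h0
      (mul_nonneg (by positivity) (pow_nonneg (sech_nonneg _) _)))]
    calc _ ≤ ((k : ℝ) + 5) / d ^ (k + 1) * (√2 ^ (k + 5) * (1 / cosh (ν * t))) * 1 := by
          gcongr
          · exact sech_pow_le (by lia) _
          · exact hτb t
      _ = _ := by ring
  · exact integrable_sech.comp_mul_left' hν.ne'
  · intro k ψ
    simp only [cos_add_two_pi, hσp ψ]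
  · intro t ψ
    have h := (hasSum_profileDeriv hd0 (abs_orbitRadius_mul_cos_lt hd ν t ψ)).mul_left
      (orbitRadius ν t * τ t * σ ψ)
    refine h.congr_fun fun k => ?_
    rw [mul_pow, pow_succ (orbitRadius ν t) (k + 4)]
    ring

lemma integral_cos_pow_mul_sin_mul_sin (n : ℕ) (m : ℤ) :
    ∫ ψ in (0 : ℝ)..(2 * π), cos ψ ^ n * sin ψ * sin (m * ψ)
      = m / (n + 1) * cosPowFourier (n + 1) m := by
  have hn : (n : ℝ) + 1 ≠ 0 := by positivity
  have hu : ∀ ψ : ℝ, HasDerivAt (fun ψ => -(cos ψ ^ (n + 1) / (n + 1))) (cos ψ ^ n * sin ψ) ψ := by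
    intro ψ
    refine ((((hasDerivAt_cos ψ).pow (n + 1)).div_const ((n : ℝ) + 1)).neg).congr_deriv ?_
    simp only [Nat.add_sub_cancel]
    push_cast
    field_simp
  have hv : ∀ ψ : ℝ, HasDerivAt (fun ψ => sin (m * ψ)) (m * cos (m * ψ)) ψ := by
    intro ψ
    refine (((hasDerivAt_id ψ).const_mul (m : ℝ)).sin).congr_deriv ?_
    simp [mul_comm]
  have h := intervalIntegral.integral_mul_deriv_eq_deriv_mul (a := 0) (b := 2 * π)
    (fun ψ _ => hu ψ) (fun ψ _ => hv ψ)
    (Continuous.intervalIntegrable (by fun_prop) _ _)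
    (Continuous.intervalIntegrable (by fun_prop) _ _)
  have hs : sin ((m : ℝ) * (2 * π)) = 0 := by
    have := sin_int_mul_add_two_pi m 0
    simpa using this
  rw [hs, mul_zero, mul_zero, sin_zero, mul_zero, sub_zero, zero_sub] at h
  rw [cosPowFourier, ← intervalIntegral.integral_const_mul, ← neg_eq_iff_eq_neg.2 h,
    ← intervalIntegral.integral_neg]
  congr 1; ext ψ
  field_simp

/-- The contribution of the power `y₁ ^ (k + 5)` of the perturbation to the Fourier coefficients,
without the prefactor independent of `k`. -/
noncomputable def amplitudeTerm (d ξ : ℝ) (m : ℤ) (k : ℕ) : ℝ :=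
  √2 ^ (k + 5) / d ^ (k + 1) * cosPowFourier (k + 5) m * sechFourier (k + 5) ξ

lemma hasSum_fourierSinCoeff_G₁ {c d ν : ℝ} (hc : 1 < c) (hd : √2 < d) (hν : 0 < ν) (γ : ℝ)
    (m₁ m₂ : ℤ) :
    HasSum (fun k => 1 / (2 * π ^ 2) * (poissonFourier c m₂ * (m₁ / ν)
      * amplitudeTerm d ((m₁ - γ * m₂) / ν) m₁ k)) (fourierSinCoeff c d γ ν G₁ m₁ m₂) := by
  have h := hasSum_coeff hc hd hν (τ := fun _ => 1) (σ := sin) continuous_const continuous_sin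
    (by simp) abs_sin_le_one sin_periodic γ m₁ m₂
  simp only [fourierSinCoeff, melnikov, alongHomoclinic_G₁ hc hd]
  refine HasSum.mul_left _ ?_
  simp only [mul_one] at h
  refine h.congr_fun fun k => ?_
  have e0 : ∫ ψ in (0 : ℝ)..(2 * π), cos ψ ^ (k + 4) * sin ψ * cos (m₁ * ψ) = 0 := by
    refine integral_eq_zero_of_periodic_of_odd (fun ψ => ?_) fun ψ => ?_
    · simp only [cos_add_two_pi, sin_add_two_pi, cos_int_mul_add_two_pi]
    · rw [mul_neg, cos_neg, cos_neg, sin_neg]; ring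
  rw [mul_assoc]
  congr 1
  rw [e0, integral_cos_pow_mul_sin_mul_sin, amplitudeTerm, sechFourier]
  have hcv := Measure.integral_comp_mul_left
    (fun s => (1 / cosh s) ^ (k + 5) * cos ((m₁ - γ * m₂) / ν * s)) ν
  rw [abs_of_pos (inv_pos.2 hν), smul_eq_mul] at hcv
  rw [show (m₁ : ℝ) / ν * (√2 ^ (k + 5) / d ^ (k + 1) * cosPowFourier (k + 5) m₁
      * ∫ s, (1 / cosh s) ^ (k + 5) * cos ((m₁ - γ * m₂) / ν * s))
      = m₁ * (√2 ^ (k + 5) / d ^ (k + 1) * cosPowFourier (k + 5) m₁) * (ν⁻¹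
      * ∫ s, (1 / cosh s) ^ (k + 5) * cos ((m₁ - γ * m₂) / ν * s)) by ring, ← hcv,
    ← integral_const_mul]
  congr 1
  ext t
  rw [orbitRadius_eq, mul_pow, show (m₁ - γ * m₂) / ν * (ν * t) = (m₁ - γ * m₂) * t by field_simp]
  push_cast
  field_simp
  ring

lemma hasSum_fourierSinCoeff_G₂ {c d ν : ℝ} (hc : 1 < c) (hd : √2 < d) (hν : 0 < ν) (γ : ℝ)
    (m₁ m₂ : ℤ) :
    HasSum (fun k => 1 / (2 * π ^ 2) * (poissonFourier c m₂ * (-((m₁ - γ * m₂) / ν) / ν)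
      * amplitudeTerm d ((m₁ - γ * m₂) / ν) m₁ k)) (fourierSinCoeff c d γ ν G₂ m₁ m₂) := by
  have h := hasSum_coeff hc hd hν (τ := fun t => tanh (ν * t)) (σ := cos)
    (continuous_tanh.comp (by fun_prop)) continuous_cos
    (fun t => (abs_tanh_lt_one _).le) abs_cos_le_one cos_periodic γ m₁ m₂
  simp only [fourierSinCoeff, melnikov, alongHomoclinic_G₂ hc hd]
  refine HasSum.mul_left _ ?_
  refine h.congr_fun fun k => ?_
  have e0 : ∫ ψ in (0 : ℝ)..(2 * π), cos ψ ^ (k + 4) * cos ψ * sin (m₁ * ψ) = 0 := by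
    refine integral_eq_zero_of_periodic_of_odd (fun ψ => ?_) fun ψ => ?_
    · simp only [cos_add_two_pi, sin_int_mul_add_two_pi]
    · rw [mul_neg, sin_neg, cos_neg, mul_neg]
  have e1 : ∫ ψ in (0 : ℝ)..(2 * π), cos ψ ^ (k + 4) * cos ψ * cos (m₁ * ψ)
      = cosPowFourier (k + 5) m₁ := by
    simp only [cosPowFourier, pow_succ]
  rw [mul_assoc]
  congr 1
  have hibp := integral_sech_pow_mul_tanh_mul_sin (n := k + 5) (by lia) ((m₁ - γ * m₂) / ν)
  have hcv := Measure.integral_comp_mul_left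
    (fun s => (1 / cosh s) ^ (k + 5) * tanh s * sin ((m₁ - γ * m₂) / ν * s)) ν
  rw [abs_of_pos (inv_pos.2 hν), smul_eq_mul] at hcv
  rw [e0, e1, amplitudeTerm]
  rw [show -((m₁ - γ * m₂) / ν) / ν * (√2 ^ (k + 5) / d ^ (k + 1) * cosPowFourier (k + 5) m₁
      * sechFourier (k + 5) ((m₁ - γ * m₂) / ν))
      = -ν⁻¹ * (√2 ^ (k + 5) / d ^ (k + 1) * cosPowFourier (k + 5) m₁)
        * ((m₁ - γ * m₂) / ν * sechFourier (k + 5) ((m₁ - γ * m₂) / ν)) by ring, ← hibp,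
    show ∀ A B C : ℝ, -ν⁻¹ * A * (B * C) = -A * B * (ν⁻¹ * C) by intros; ring, ← hcv,
    ← integral_const_mul]
  congr 1
  ext t
  rw [orbitRadius_eq, mul_pow, show (m₁ - γ * m₂) / ν * (ν * t) = (m₁ - γ * m₂) * t by field_simp]
  push_cast
  ring

/-- The two coefficients are proportional: `x₁ f'(y₁)` is, up to the factor `-1 / ν`, the derivative
of `f(R(t) cos ψ)` in `t` at fixed `ψ`, and `y₂ f'(y₁)` is minus its derivative in `ψ`. -/
lemma fourierSinCoeff_G₂_eq {c d ν : ℝ} (hc : 1 < c) (hd : √2 < d) (hν : 0 < ν) (γ : ℝ)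
    {m₁ : ℤ} (hm : m₁ ≠ 0) (m₂ : ℤ) :
    fourierSinCoeff c d γ ν G₂ m₁ m₂
      = -((m₁ - γ * m₂) / ν) / m₁ * fourierSinCoeff c d γ ν G₁ m₁ m₂ := by
  have hm' : (m₁ : ℝ) ≠ 0 := by exact_mod_cast hm
  refine (hasSum_fourierSinCoeff_G₂ hc hd hν γ m₁ m₂).unique
    (((hasSum_fourierSinCoeff_G₁ hc hd hν γ m₁ m₂).mul_left _).congr_fun fun k => ?_)
  field_simp

/-! ### Stirling estimates -/

/-- The primitive, vanishing at `0`, of `x ↦ log (x² + ξ²) / 2`. -/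
noncomputable def logPrimitive (ξ x : ℝ) : ℝ := x / 2 * log (x ^ 2 + ξ ^ 2) - x + ξ * arctan (x / ξ)

lemma hasDerivAt_logPrimitive {ξ : ℝ} (hξ : 0 < ξ) (x : ℝ) :
    HasDerivAt (logPrimitive ξ) (log (x ^ 2 + ξ ^ 2) / 2) x := by
  have h0 : x ^ 2 + ξ ^ 2 ≠ 0 := by positivity
  have h1 : HasDerivAt (fun x : ℝ => x ^ 2 + ξ ^ 2) (2 * x) x := by
    simpa using (hasDerivAt_pow 2 x).add_const (ξ ^ 2)
  have h := ((((hasDerivAt_id x).div_const 2).mul (h1.log h0)).sub (hasDerivAt_id x)).add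
    ((((hasDerivAt_id x).div_const ξ).arctan).const_mul ξ)
  refine h.congr_deriv ?_
  have h2 : 1 + (x / ξ) ^ 2 = (x ^ 2 + ξ ^ 2) / ξ ^ 2 := by field_simp; ring
  simp only [id]
  rw [h2]
  field_simp
  ring

@[simp] lemma logPrimitive_zero (ξ : ℝ) : logPrimitive ξ 0 = 0 := by simp [logPrimitive]

lemma logPrimitive_increment {ξ : ℝ} (hξ : 0 < ξ) {a b : ℝ} (ha : 0 ≤ a) (hab : a < b) :
    (b - a) * (log (a ^ 2 + ξ ^ 2) / 2) ≤ logPrimitive ξ b - logPrimitive ξ a ∧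
      logPrimitive ξ b - logPrimitive ξ a ≤ (b - a) * (log (b ^ 2 + ξ ^ 2) / 2) := by
  obtain ⟨z, hz, h⟩ := exists_hasDerivAt_eq_slope (logPrimitive ξ) _ hab
    (fun x _ => (hasDerivAt_logPrimitive hξ x).continuousAt.continuousWithinAt)
    (fun x _ => hasDerivAt_logPrimitive hξ x)
  have hba : 0 < b - a := sub_pos.2 hab
  have h' : logPrimitive ξ b - logPrimitive ξ a = (b - a) * (log (z ^ 2 + ξ ^ 2) / 2) := by
    rw [h]; field_simp
  have hz0 : 0 < z := ha.trans_lt hz.1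
  rw [h']
  constructor
  · gcongr; exact hz.1.le
  · gcongr; exact hz.2.le

/-- Two-sided Stirling estimate, up to polynomial factors, for
`∫ sechⁿ⁺¹(s) cos (ξ s) ds · n! = 2ⁿ |Γ((n + 1 + i ξ) / 2)|²`. -/
lemma sechFourier_bounds {ξ : ℝ} (hξ : 1 ≤ ξ) (n : ℕ) :
    sechFourier (n + 1) ξ * n.factorial
        ≤ 4 * π * ξ * exp (logPrimitive ξ (n + 1) - π * ξ / 2) ∧
      exp (logPrimitive ξ (n + 1) - π * ξ / 2)
        ≤ sechFourier (n + 1) ξ * n.factorial * (((n : ℝ) + 1) ^ 2 + ξ ^ 2) := by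
  have hξ0 : 0 < ξ := by linarith
  have hπ := pi_gt_three
  have hpos : ∀ a : ℝ, 0 ≤ a → 0 ≤ logPrimitive ξ a ∧
      logPrimitive ξ a ≤ a * (log (a ^ 2 + ξ ^ 2) / 2) := by
    intro a ha
    rcases ha.eq_or_lt with rfl | ha
    · simp
    have h := logPrimitive_increment hξ0 le_rfl ha
    have h0 : 0 ≤ log (0 ^ 2 + ξ ^ 2) := log_nonneg (by nlinarith)
    rw [logPrimitive_zero, sub_zero, sub_zero] at h
    exact ⟨le_trans (by positivity) h.1, h.2⟩
  have hE : 0 < exp (π * ξ / 2) := exp_pos _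
  have hE2 : 2 < exp (π * ξ / 2) := by
    have := add_one_le_exp (π * ξ / 2)
    nlinarith
  have hneg : exp (-(π * ξ / 2)) ≤ 1 := exp_le_one_iff.2 (by simp; positivity)
  induction n using Nat.twoStepInduction with
  | zero =>
    obtain ⟨p1, p2⟩ := hpos 1 zero_le_one
    simp only [zero_add, sechFourier_one, Nat.factorial_zero, Nat.cast_one, mul_one, Nat.cast_zero]
    have hc := cosh_pos (π * ξ / 2)
    have hc2 : exp (π * ξ / 2) ≤ 2 * cosh (π * ξ / 2) := by
      rw [Real.cosh_eq]; have := exp_pos (-(π * ξ / 2)); linarith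
    have hc3 : cosh (π * ξ / 2) ≤ exp (π * ξ / 2) := by
      rw [Real.cosh_eq]; linarith
    constructor
    · rw [exp_sub, div_le_iff₀ hc]
      have : (1 : ℝ) ≤ exp (logPrimitive ξ 1) := one_le_exp p1
      calc π ≤ 4 * π * ξ * (1 / exp (π * ξ / 2)) * (exp (π * ξ / 2) / 2) := by
            field_simp; linarith
        _ ≤ _ := by gcongr; linarith
    · have : exp (logPrimitive ξ 1) ≤ 1 ^ 2 + ξ ^ 2 := by
        rw [← le_log_iff_exp_le (by positivity)]
        have : 0 ≤ log (1 ^ 2 + ξ ^ 2) := log_nonneg (by nlinarith)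
        exact p2.trans (by rw [one_mul]; exact half_le_self this)
      rw [exp_sub, div_mul_eq_mul_div, div_le_div_iff₀ hE hc]
      calc _ ≤ (1 ^ 2 + ξ ^ 2) * exp (π * ξ / 2) := by gcongr
        _ = 1 * (1 ^ 2 + ξ ^ 2) * exp (π * ξ / 2) := by ring
        _ ≤ _ := by gcongr; linarith
  | one =>
    obtain ⟨p1, p2⟩ := hpos 2 zero_le_two
    norm_num only [sechFourier_two hξ0.ne', Nat.factorial_one, Nat.cast_one, mul_one, Nat.reduceAdd]
    have hs : 0 < sinh (π * ξ / 2) := Real.sinh_pos_iff.2 (by positivity)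
    have hs2 : exp (π * ξ / 2) ≤ 4 * sinh (π * ξ / 2) := by
      rw [Real.sinh_eq]; linarith
    have hs3 : sinh (π * ξ / 2) ≤ exp (π * ξ / 2) := by
      rw [Real.sinh_eq]; have := exp_pos (-(π * ξ / 2)); linarith
    constructor
    · rw [exp_sub, div_le_iff₀ hs]
      have : (1 : ℝ) ≤ exp (logPrimitive ξ 2) := one_le_exp p1
      calc π * ξ = 4 * π * ξ * (1 / exp (π * ξ / 2)) * (exp (π * ξ / 2) / 4) := by
            field_simp
        _ ≤ _ := by gcongr; linarith
    · have : exp (logPrimitive ξ 2) ≤ 2 ^ 2 + ξ ^ 2 := by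
        rw [← le_log_iff_exp_le (by positivity)]
        exact p2.trans_eq (by ring)
      norm_num only at this
      rw [exp_sub, div_mul_eq_mul_div, div_le_div_iff₀ hE hs]
      calc _ ≤ (4 + ξ ^ 2) * exp (π * ξ / 2) := by gcongr
        _ = 1 * (4 + ξ ^ 2) * exp (π * ξ / 2) := by ring
        _ ≤ _ := by gcongr; nlinarith
  | more n ih _ =>
    set N : ℝ := (n : ℝ) + 1 with hN
    have hN0 : 0 < N := by positivity
    have hinc := logPrimitive_increment hξ0 hN0.le (show N < N + 2 by linarith)
    have h2 : ((n + 2 : ℕ) : ℝ) + 1 = N + 2 := by push_cast; ring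
    have hstep : sechFourier (n + 2 + 1) ξ * (n + 2).factorial
        = sechFourier (n + 1) ξ * n.factorial * (N ^ 2 + ξ ^ 2) := by
      rw [show n + 2 + 1 = (n + 1) + 2 by ring, sechFourier_add_two n.succ_ne_zero,
        Nat.factorial_succ, Nat.factorial_succ]
      push_cast
      rw [← hN]
      have : (n : ℝ) + 1 + 1 ≠ 0 := by positivity
      field_simp
    have hq : 0 < N ^ 2 + ξ ^ 2 := by positivity
    have hq2 : 0 < (N + 2) ^ 2 + ξ ^ 2 := by positivity
    rw [hstep, h2]
    constructor
    · refine (mul_le_mul_of_nonneg_right ih.1 hq.le).trans ?_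
      rw [mul_assoc]
      refine mul_le_mul_of_nonneg_left ?_ (by positivity)
      calc _ = exp (logPrimitive ξ N - π * ξ / 2 + log (N ^ 2 + ξ ^ 2)) := by
            rw [exp_add, exp_log hq]
        _ ≤ _ := exp_le_exp.2 (by linarith [hinc.1])
    · refine le_trans ?_ (mul_le_mul_of_nonneg_right ih.2 hq2.le)
      calc _ ≤ exp (logPrimitive ξ N - π * ξ / 2 + log ((N + 2) ^ 2 + ξ ^ 2)) :=
            exp_le_exp.2 (by linarith [hinc.2])
        _ = _ := by rw [exp_add, exp_log hq2]

lemma exp_le_factorial (n : ℕ) : exp (n * log n - n) ≤ n.factorial := by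
  rcases n.eq_zero_or_pos with rfl | hn
  · simp
  have hn' : (0 : ℝ) < n := by exact_mod_cast hn
  have h := Real.pow_div_factorial_le_exp n hn'.le n
  rw [div_le_iff₀ (by positivity)] at h
  rw [exp_sub, div_le_iff₀ (exp_pos _), mul_comm (n : ℝ), exp_mul, exp_log hn', rpow_natCast]
  linarith

lemma factorial_le_exp {n : ℕ} (hn : 1 ≤ n) :
    (n.factorial : ℝ) ≤ exp 1 * n * exp (n * log n - n) := by
  induction n, hn using Nat.le_induction with
  | base => simp [← exp_add]
  | succ n hn ih =>
    have hn' : (0 : ℝ) < n := by exact_mod_cast hn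
    have hlog : 1 / ((n : ℝ) + 1) ≤ log (n + 1) - log n := by
      rw [← log_div (by positivity) hn'.ne']
      have := one_sub_inv_le_log_of_pos (show 0 < ((n : ℝ) + 1) / n by positivity)
      refine le_trans (le_of_eq ?_) this
      field_simp; ring
    have hlog' : 1 ≤ ((n : ℝ) + 1) * (log (n + 1) - log n) := by
      calc (1 : ℝ) = ((n : ℝ) + 1) * (1 / (n + 1)) := by field_simp
        _ ≤ _ := by gcongr
    rw [Nat.factorial_succ]
    push_cast
    calc ((n : ℝ) + 1) * n.factorial ≤ (n + 1) * (exp 1 * n * exp (n * log n - n)) := by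
          gcongr
      _ = exp 1 * (n + 1) * (exp (log n) * exp (n * log n - n)) := by
          rw [exp_log hn']; ring
      _ ≤ exp 1 * (n + 1) * (exp ((n + 1) * log (n + 1) - (n + 1))) := by
          rw [← exp_add]
          gcongr
          linarith

/-! ### The rate function and its maximum -/

/-- The exponential rate of the `j`-th term of the positive series for the amplitude, as a function
of a real variable `x` in place of `j`. -/
noncomputable def rate (d ξ M x : ℝ) : ℝ :=
  -(M + 2 * x) * (log d + log 2 / 2) + (logPrimitive ξ (M + 2 * x) - π * ξ / 2) + (M + 2 * x)
    - x * log x - (M + x) * log (M + x)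

lemma hasDerivAt_rate {d ξ M x : ℝ} (hd : 0 < d) (hξ : 0 < ξ) (hM : 0 < M) (hx : 0 < x) :
    HasDerivAt (rate d ξ M)
      (log (((M + 2 * x) ^ 2 + ξ ^ 2) / (2 * d ^ 2 * (x * (M + x))))) x := by
  have h1 : HasDerivAt (fun x => M + 2 * x) 2 x := by
    simpa using ((hasDerivAt_id x).const_mul 2).const_add M
  have h2 : HasDerivAt (fun x => M + x) 1 x := (hasDerivAt_id x).const_add M
  have h3 := (hasDerivAt_logPrimitive hξ (M + 2 * x)).comp x h1
  have h4 := (Real.hasDerivAt_mul_log (show M + x ≠ 0 by positivity)).comp x h2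
  have h := ((((h1.neg.mul_const (log d + log 2 / 2)).add (h3.sub_const (π * ξ / 2))).add h1).sub
    (Real.hasDerivAt_mul_log hx.ne')).sub h4
  refine h.congr_deriv ?_
  rw [log_div (by positivity) (by positivity), log_mul (by positivity) (by positivity),
    log_mul (by positivity) (by positivity), log_mul (by positivity) (by positivity), log_pow]
  push_cast
  ring

lemma continuous_rate {d ξ M : ℝ} (hξ : 0 < ξ) : Continuous (rate d ξ M) := by
  have h1 : Continuous (logPrimitive ξ) := by
    rw [continuous_iff_continuousAt]
    exact fun x => (hasDerivAt_logPrimitive hξ x).continuousAt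
  have h2 : Continuous fun x : ℝ => (M + x) * log (M + x) :=
    Real.continuous_mul_log.comp (continuous_const.add continuous_id)
  have h3 := Real.continuous_mul_log
  have h4 : Continuous fun x : ℝ => logPrimitive ξ (M + 2 * x) := h1.comp (by fun_prop)
  unfold rate
  fun_prop

section Root

variable {d L : ℝ}

lemma two_mul_sq_sub_four_pos (hd : √2 < d) : 0 < 2 * d ^ 2 - 4 := by
  have h0 := Real.sqrt_nonneg 2
  have h := Real.sq_sqrt (show (0 : ℝ) ≤ 2 by norm_num)
  nlinarith

lemma Istar_pos (hd : √2 < d) (hL : 0 < L) : 0 < Istar d L := by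
  have hd' := two_mul_sq_sub_four_pos hd
  have : 1 < √(1 + 4 * (1 + 1 / L ^ 2) / (2 * d ^ 2 - 4)) := by
    rw [Real.lt_sqrt zero_le_one]
    have : 0 < 4 * (1 + 1 / L ^ 2) / (2 * d ^ 2 - 4) := by positivity
    linarith
  rw [Istar]; linarith

lemma Istar_eq (hd : √2 < d) (hL : 0 < L) :
    (2 * d ^ 2 - 4) * (Istar d L ^ 2 + Istar d L) = 1 + 1 / L ^ 2 := by
  have hd' := two_mul_sq_sub_four_pos hd
  have h := Real.sq_sqrt (show 0 ≤ 1 + 4 * (1 + 1 / L ^ 2) / (2 * d ^ 2 - 4) by positivity)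
  have h2 : Istar d L ^ 2 + Istar d L = (1 + 1 / L ^ 2) / (2 * d ^ 2 - 4) := by
    rw [Istar]
    linear_combination h / 4
  rw [h2]; field_simp

lemma Istar_anti (hd : √2 < d) {L' : ℝ} (hL : 0 < L) (h : L ≤ L') : Istar d L' ≤ Istar d L := by
  have hd' := two_mul_sq_sub_four_pos hd
  unfold Istar
  gcongr

end Root

section Maximum

variable {d L M : ℝ}

lemma add_two_mul_sq_add_sq (hd : √2 < d) (hL : 0 < L) (x : ℝ) :
    (M + 2 * x) ^ 2 + (M / L) ^ 2
      = (2 * d ^ 2 - 4) * (Istar d L * M * (M + Istar d L * M)) + 4 * (x * (M + x)) := by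
  have h := Istar_eq hd hL
  have : (M / L) ^ 2 = M ^ 2 * (1 / L ^ 2) := by ring
  rw [this]
  linear_combination M ^ 2 * (-h)

lemma rate_monotoneOn (hd : √2 < d) (hL : 0 < L) (hM : 0 < M) :
    MonotoneOn (rate d (M / L) M) (Icc 0 (Istar d L * M)) := by
  have hd0 : 0 < d := (Real.sqrt_nonneg 2).trans_lt hd
  have hd' := two_mul_sq_sub_four_pos hd
  have hI := Istar_pos hd hL
  refine monotoneOn_of_deriv_nonneg (convex_Icc _ _) (continuous_rate (by positivity)).continuousOn
    ?_ ?_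
  · rw [interior_Icc]
    exact fun x hx =>
      (hasDerivAt_rate hd0 (by positivity) hM hx.1).differentiableAt.differentiableWithinAt
  · rw [interior_Icc]
    intro x hx
    have hx0 := hx.1
    rw [(hasDerivAt_rate hd0 (by positivity) hM hx.1).deriv]
    refine log_nonneg ((one_le_div (by positivity)).2 ?_)
    rw [add_two_mul_sq_add_sq hd hL]
    have : x * (M + x) ≤ Istar d L * M * (M + Istar d L * M) := by
      have := hx.2.le
      gcongr
    nlinarith

lemma rate_antitoneOn (hd : √2 < d) (hL : 0 < L) (hM : 0 < M) :
    AntitoneOn (rate d (M / L) M) (Ici (Istar d L * M)) := by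
  have hd0 : 0 < d := (Real.sqrt_nonneg 2).trans_lt hd
  have hd' := two_mul_sq_sub_four_pos hd
  have hI := Istar_pos hd hL
  have hpos : ∀ x ∈ Ioi (Istar d L * M), 0 < x := fun x hx => lt_trans (by positivity) hx
  refine antitoneOn_of_deriv_nonpos (convex_Ici _) (continuous_rate (by positivity)).continuousOn
    ?_ ?_
  · rw [interior_Ici]
    exact fun x hx =>
      (hasDerivAt_rate hd0 (by positivity) hM (hpos x hx)).differentiableAt.differentiableWithinAt
  · rw [interior_Ici]
    intro x hx
    have hx0 := hpos x hx
    rw [(hasDerivAt_rate hd0 (by positivity) hM hx0).deriv]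
    refine log_nonpos (by positivity) ((div_le_one (by positivity)).2 ?_)
    rw [add_two_mul_sq_add_sq hd hL]
    have : Istar d L * M * (M + Istar d L * M) ≤ x * (M + x) := by
      have := (show Istar d L * M < x from hx).le
      gcongr
    nlinarith

/-- Beyond twice the maximum, the rate decreases at least linearly. -/
lemma rate_add_mul_antitoneOn (hd : √2 < d) (hL : 0 < L) (hM : 0 < M) :
    AntitoneOn (fun x => rate d (M / L) M x + x * -log (1 / 2 + 1 / d ^ 2))
      (Ici (2 * Istar d L * M)) := by
  have hd0 : 0 < d := (Real.sqrt_nonneg 2).trans_lt hd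
  have hd' := two_mul_sq_sub_four_pos hd
  have hI := Istar_pos hd hL
  have hpos : ∀ x ∈ Ioi (2 * Istar d L * M), 0 < x := fun x hx => lt_trans (by positivity) hx
  have hder : ∀ x, 0 < x → HasDerivAt
      (fun x => rate d (M / L) M x + x * -log (1 / 2 + 1 / d ^ 2)) _ x := fun x hx =>
    (hasDerivAt_rate hd0 (show 0 < M / L by positivity) hM hx).add
      ((hasDerivAt_id x).mul_const (-log (1 / 2 + 1 / d ^ 2)))
  refine antitoneOn_of_deriv_nonpos (convex_Ici _)
    ((continuous_rate (by positivity)).add (by fun_prop)).continuousOn ?_ ?_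
  · rw [interior_Ici]
    exact fun x hx => (hder x (hpos x hx)).differentiableAt.differentiableWithinAt
  · rw [interior_Ici]
    intro x hx
    have hx0 := hpos x hx
    rw [(hder x hx0).deriv, one_mul, ← sub_eq_add_neg, sub_nonpos]
    refine log_le_log (by positivity) ?_
    rw [div_le_iff₀ (by positivity), add_two_mul_sq_add_sq hd hL]
    have : 2 * (Istar d L * M * (M + Istar d L * M)) ≤ x * (M + x) := by
      have h1 : 2 * Istar d L * M < x := hx
      have h2 : 0 < Istar d L * M := by positivity
      calc 2 * (Istar d L * M * (M + Istar d L * M))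
          = 2 * Istar d L * M * (M + Istar d L * M) := by ring
        _ ≤ x * (M + x) := by gcongr; linarith
    have e : (1 / 2 + 1 / d ^ 2) * (2 * d ^ 2 * (x * (M + x))) = (d ^ 2 + 2) * (x * (M + x)) := by
      field_simp
    rw [e]
    nlinarith

/-- Beyond its maximum the rate decreases at most linearly, so that it changes by a bounded amount
between the maximum and the next integer. -/
lemma rate_add_mul_monotoneOn (hd : √2 < d) (hL : 0 < L) (hM : 0 < M) :
    MonotoneOn (fun x => rate d (M / L) M x + x * log (d ^ 2 / 2)) (Ici (Istar d L * M)) := by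
  have hd0 : 0 < d := (Real.sqrt_nonneg 2).trans_lt hd
  have hd' := two_mul_sq_sub_four_pos hd
  have hI := Istar_pos hd hL
  have hpos : ∀ x ∈ Ioi (Istar d L * M), 0 < x := fun x hx => lt_trans (by positivity) hx
  have hder : ∀ x, 0 < x → HasDerivAt
      (fun x => rate d (M / L) M x + x * log (d ^ 2 / 2)) _ x := fun x hx =>
    (hasDerivAt_rate hd0 (show 0 < M / L by positivity) hM hx).add
      ((hasDerivAt_id x).mul_const (log (d ^ 2 / 2)))
  refine monotoneOn_of_deriv_nonneg (convex_Ici _)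
    ((continuous_rate (by positivity)).add (by fun_prop)).continuousOn ?_ ?_
  · rw [interior_Ici]
    exact fun x hx => (hder x (hpos x hx)).differentiableAt.differentiableWithinAt
  · rw [interior_Ici]
    intro x hx
    have hx0 := hpos x hx
    rw [(hder x hx0).deriv, one_mul, ← log_mul (by positivity) (by positivity)]
    refine log_nonneg ?_
    rw [add_two_mul_sq_add_sq hd hL, div_mul_div_comm, one_le_div (by positivity)]
    have : 0 < (2 * d ^ 2 - 4) * (Istar d L * M * (M + Istar d L * M)) := by positivity
    nlinarith [pow_pos hd0 2]

lemma neg_log_half_add_pos (hd : √2 < d) : 0 < -log (1 / 2 + 1 / d ^ 2) := by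
  have hd0 : 0 < d := (Real.sqrt_nonneg 2).trans_lt hd
  have hd' := two_mul_sq_sub_four_pos hd
  rw [neg_pos]
  refine log_neg (by positivity) ?_
  have : 1 / d ^ 2 < 1 / 2 := one_div_lt_one_div_of_lt (by norm_num) (by linarith)
  linarith

/-- The rate is at most its maximum, up to a linear correction which makes the terms summable and
which is bounded as long as `x` is comparable to `M`. -/
lemma rate_le (hd : √2 < d) (hL : 0 < L) (hM : 1 ≤ M) {x : ℝ} (hx : 0 ≤ x) :
    rate d (M / L) M x ≤ rate d (M / L) M (Istar d L * M)
      - -log (1 / 2 + 1 / d ^ 2) / M * (x - 2 * Istar d L * M) := by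
  have hM0 : 0 < M := by linarith
  have hI := Istar_pos hd hL
  have hδ := neg_log_half_add_pos hd
  set δ := -log (1 / 2 + 1 / d ^ 2)
  have hIM : 0 < Istar d L * M := by positivity
  rcases le_total x (2 * Istar d L * M) with h | h
  · have h1 : rate d (M / L) M x ≤ rate d (M / L) M (Istar d L * M) := by
      rcases le_total x (Istar d L * M) with h' | h'
      · exact rate_monotoneOn hd hL hM0 ⟨hx, h'⟩ ⟨hIM.le, le_rfl⟩ h'
      · exact rate_antitoneOn hd hL hM0 (mem_Ici.2 le_rfl) h' h'
    have : δ / M * (x - 2 * Istar d L * M) ≤ 0 :=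
      mul_nonpos_of_nonneg_of_nonpos (by positivity) (by linarith)
    linarith
  · have h1 := rate_add_mul_antitoneOn hd hL hM0 (mem_Ici.2 le_rfl) (mem_Ici.2 h) h
    have h2 := rate_antitoneOn hd hL hM0 (mem_Ici.2 le_rfl)
      (show 2 * Istar d L * M ∈ Ici (Istar d L * M) by rw [mem_Ici]; linarith) (by linarith)
    have h3 : δ / M * (x - 2 * Istar d L * M) ≤ δ * (x - 2 * Istar d L * M) :=
      mul_le_mul_of_nonneg_right (div_le_self hδ.le hM) (by linarith)
    simp only at h1
    change rate d (M / L) M x + x * δ ≤ rate d (M / L) M (2 * Istar d L * M)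
      + 2 * Istar d L * M * δ at h1
    nlinarith

lemma rate_max_eq (c γ : ℝ) (hd : √2 < d) (hL : 0 < L) (hM : 0 < M) :
    rate d (M / L) M (Istar d L * M)
      = M * (Psi11 c d γ L + Psi12 d L) + M * (log (rho c) / |γ|) := by
  have hd0 : 0 < d := (Real.sqrt_nonneg 2).trans_lt hd
  have hI := Istar_pos hd hL
  rw [rate, logPrimitive, Psi11, Psi12, K]
  set I := Istar d L
  have e1 : M + 2 * (I * M) = M * (1 + 2 * I) := by ring
  have e2 : M * (1 + 2 * I) / (M / L) = (1 + 2 * I) * L := by field_simp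
  have e3 : (M * (1 + 2 * I)) ^ 2 + (M / L) ^ 2 = (M / L) ^ 2 * (1 + ((1 + 2 * I) * L) ^ 2) := by
    field_simp; ring
  have e4 : M + I * M = M * (1 + I) := by ring
  rw [e1, e2, e3, e4, log_mul (by positivity) (by positivity), log_pow,
    log_div hM.ne' hL.ne', log_mul hI.ne' hM.ne', log_mul hM.ne' (by positivity),
    log_mul hL.ne' hd0.ne']
  push_cast
  field_simp
  ring

end Maximum

/-! ### Laplace's method for the amplitude series -/

/-- The nonzero terms of the amplitude series in factorial form. -/
lemma amplitudeTerm_eq {d : ℝ} (hd : 0 < d) (ξ : ℝ) {m : ℕ} (hm : 5 ≤ m) (j : ℕ) :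
    amplitudeTerm d ξ m (m - 5 + 2 * j)
      = 2 * π * d ^ 4 * ((m : ℝ) + 2 * j) * exp (-((m : ℝ) + 2 * j) * (log d + log 2 / 2))
        * (sechFourier (m + 2 * j) ξ * (m + 2 * j - 1).factorial)
        / (j.factorial * (m + j).factorial) := by
  have hk : m - 5 + 2 * j + 5 = m + 2 * j := by lia
  have hd1 : d ^ (m + 2 * j) = d ^ (m - 5 + 2 * j + 1) * d ^ 4 := by
    rw [← pow_add]; congr 1; lia
  have hexp : exp (-((m : ℝ) + 2 * j) * (log d + log 2 / 2))
      = √2 ^ (m + 2 * j) / (2 ^ (m + 2 * j) * d ^ (m + 2 * j)) := by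
    have h2 : log 2 / 2 = log (2 / √2) := by
      rw [log_div two_ne_zero (by positivity), Real.log_sqrt zero_le_two]; ring
    have h3 : (m : ℝ) + 2 * j = ((m + 2 * j : ℕ) : ℝ) := by push_cast; ring
    rw [h2, ← log_mul hd.ne' (by positivity), neg_mul, exp_neg, mul_comm, exp_mul,
      exp_log (by positivity), h3, rpow_natCast, mul_pow, div_pow]
    field_simp
  have hch : ((m + 2 * j).choose j : ℝ) * (j.factorial * (m + j).factorial)
      = ((m : ℝ) + 2 * j) * (m + 2 * j - 1).factorial := by
    have h := Nat.choose_mul_factorial_mul_factorial (show j ≤ m + 2 * j by lia)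
    rw [show m + 2 * j - j = m + j by lia,
      ← Nat.mul_factorial_pred (show m + 2 * j ≠ 0 by lia)] at h
    have h' := congrArg (Nat.cast (R := ℝ)) h
    push_cast at h'
    linarith
  rw [amplitudeTerm, hk, cosPowFourier_add_two_mul, hexp, hd1, eq_div_iff (by positivity)]
  calc _ = √2 ^ (m + 2 * j) / d ^ (m - 5 + 2 * j + 1) * (2 * π / 2 ^ (m + 2 * j))
        * sechFourier (m + 2 * j) ξ
        * (((m + 2 * j).choose j : ℝ) * (j.factorial * (m + j).factorial)) := by ring
    _ = _ := by rw [hch]; field_simp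

lemma hasSum_amplitudeTerm_iff (d ξ : ℝ) {m : ℕ} (hm : 5 ≤ m) (T : ℝ) :
    HasSum (fun j : ℕ => amplitudeTerm d ξ m (m - 5 + 2 * j)) T
      ↔ HasSum (amplitudeTerm d ξ m) T := by
  have hinj : Function.Injective fun j : ℕ => m - 5 + 2 * j :=
    fun a b h => by simp only at h; lia
  refine hinj.hasSum_iff (f := amplitudeTerm d ξ m) fun k hk => ?_
  rw [amplitudeTerm, cosPowFourier_eq_zero m (k + 5), mul_zero, zero_mul]
  rintro ⟨j, hj⟩
  exact hk ⟨j, by simp only at hj ⊢; lia⟩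

lemma amplitudeTerm_le {d ξ : ℝ} (hd : 0 < d) (hξ : 1 ≤ ξ) {m : ℕ} (hm : 5 ≤ m) (j : ℕ) :
    amplitudeTerm d ξ m (m - 5 + 2 * j)
      ≤ 8 * π ^ 2 * d ^ 4 * ξ * ((m : ℝ) + 2 * j) * exp (rate d ξ m j) := by
  rw [amplitudeTerm_eq hd ξ hm]
  have hQ := (sechFourier_bounds hξ (m + 2 * j - 1)).1
  have h1 : m + 2 * j - 1 + 1 = m + 2 * j := by lia
  have h2 : ((m + 2 * j - 1 : ℕ) : ℝ) + 1 = (m : ℝ) + 2 * j := by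
    have := congrArg (Nat.cast (R := ℝ)) h1
    push_cast at this
    exact this
  rw [h1, h2] at hQ
  have hj := exp_le_factorial j
  have hmj := exp_le_factorial (m + j)
  have hr : exp (rate d ξ m j) = exp (-((m : ℝ) + 2 * j) * (log d + log 2 / 2))
      * exp (logPrimitive ξ (m + 2 * j) - π * ξ / 2)
      / (exp (j * log j - j) * exp ((m + j : ℕ) * log (m + j : ℕ) - (m + j : ℕ))) := by
    rw [← exp_add, ← exp_add, ← exp_sub, rate]
    push_cast
    congr 1; ring
  rw [hr]
  calc _ ≤ 2 * π * d ^ 4 * ((m : ℝ) + 2 * j) * exp (-((m : ℝ) + 2 * j) * (log d + log 2 / 2))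
        * (4 * π * ξ * exp (logPrimitive ξ (m + 2 * j) - π * ξ / 2))
        / (exp (j * log j - j) * exp ((m + j : ℕ) * log (m + j : ℕ) - (m + j : ℕ))) := by
        gcongr
    _ = _ := by ring

lemma le_amplitudeTerm {d ξ : ℝ} (hd : 0 < d) (hξ : 1 ≤ ξ) {m : ℕ} (hm : 5 ≤ m) {j : ℕ}
    (hj1 : 1 ≤ j) :
    2 * π * d ^ 4 * exp (rate d ξ m j)
        / (exp 2 * (((m : ℝ) + 2 * j) * (((m : ℝ) + 2 * j) ^ 2 + ξ ^ 2)))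
      ≤ amplitudeTerm d ξ m (m - 5 + 2 * j) := by
  rw [amplitudeTerm_eq hd ξ hm]
  have hQ := (sechFourier_bounds hξ (m + 2 * j - 1)).2
  have h1 : m + 2 * j - 1 + 1 = m + 2 * j := by lia
  have h2 : ((m + 2 * j - 1 : ℕ) : ℝ) + 1 = (m : ℝ) + 2 * j := by
    have := congrArg (Nat.cast (R := ℝ)) h1
    push_cast at this
    exact this
  rw [h1, h2] at hQ
  have hj := factorial_le_exp hj1
  have hmj := factorial_le_exp (show 1 ≤ m + j by lia)
  have hm0 : (0 : ℝ) < m := by positivity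
  have hj0 : (0 : ℝ) < j := by exact_mod_cast hj1
  set N : ℝ := (m : ℝ) + 2 * j with hN
  have hN0 : 0 < N := by positivity
  have hq : 0 < N ^ 2 + ξ ^ 2 := by positivity
  have hr : exp (rate d ξ m j) = exp (-N * (log d + log 2 / 2))
      * exp (logPrimitive ξ N - π * ξ / 2)
      / (exp (j * log j - j) * exp ((m + j : ℕ) * log (m + j : ℕ) - (m + j : ℕ))) := by
    rw [← exp_add, ← exp_add, ← exp_sub, rate]
    push_cast
    congr 1; rw [hN]; ring
  rw [← div_le_iff₀ hq] at hQ
  have hQ0 : 0 ≤ sechFourier (m + 2 * j) ξ * (m + 2 * j - 1).factorial :=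
    le_trans (by positivity) hQ
  have hprod : (j : ℝ) * (m + j : ℕ) ≤ N * N := by
    push_cast
    gcongr <;> linarith
  have he : exp (2 : ℝ) = exp 1 * exp 1 := by rw [← exp_add]; norm_num
  rw [hr, he]
  calc _ = 2 * π * d ^ 4 * N * exp (-N * (log d + log 2 / 2))
        * (exp (logPrimitive ξ N - π * ξ / 2) / (N ^ 2 + ξ ^ 2))
        / ((exp 1 * exp 1) * (N * N) * (exp (j * log j - j)
          * exp ((m + j : ℕ) * log (m + j : ℕ) - (m + j : ℕ)))) := by field_simp
    _ ≤ 2 * π * d ^ 4 * N * exp (-N * (log d + log 2 / 2))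
        * (exp (logPrimitive ξ N - π * ξ / 2) / (N ^ 2 + ξ ^ 2))
        / ((exp 1 * exp 1) * (j * (m + j : ℕ)) * (exp (j * log j - j)
          * exp ((m + j : ℕ) * log (m + j : ℕ) - (m + j : ℕ)))) := by gcongr
    _ = 2 * π * d ^ 4 * N * exp (-N * (log d + log 2 / 2))
        * (exp (logPrimitive ξ N - π * ξ / 2) / (N ^ 2 + ξ ^ 2))
        / ((exp 1 * j * exp (j * log j - j)) * (exp 1 * (m + j : ℕ)
          * exp ((m + j : ℕ) * log (m + j : ℕ) - (m + j : ℕ)))) := by congr 1; ring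
    _ ≤ _ := by
        gcongr

lemma amplitudeTerm_pos {d ξ : ℝ} (hd : 0 < d) (hξ : 0 < ξ) {m : ℕ} (hm : 5 ≤ m) (j : ℕ) :
    0 < amplitudeTerm d ξ m (m - 5 + 2 * j) := by
  rw [amplitudeTerm_eq hd ξ hm]
  have := sechFourier_pos ξ hξ (m + 2 * j - 1)
  rw [show m + 2 * j - 1 + 1 = m + 2 * j by lia] at this
  have hm0 : (0 : ℝ) < m := by positivity
  positivity

lemma tsum_linear_mul_geometric_le {M δ : ℝ} (hM : 1 ≤ M) (hδ : 0 < δ) :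
    Summable (fun j : ℕ => (M + 2 * j) * exp (-δ / M) ^ j) ∧
      ∑' j : ℕ, (M + 2 * j) * exp (-δ / M) ^ j
        ≤ M ^ 2 * ((1 + 1 / δ) + 2 * (1 + 1 / δ) ^ 2) := by
  have hM0 : 0 < M := by linarith
  set q := exp (-δ / M) with hq
  have hq0 : 0 < q := exp_pos _
  have hq1 : q < 1 := Real.exp_lt_one_iff.2 (by rw [neg_div]; exact neg_neg_of_pos (by positivity))
  have hn : ‖q‖ < 1 := by rwa [Real.norm_of_nonneg hq0.le]
  have h := ((hasSum_geometric_of_norm_lt_one hn).mul_left M).add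
    ((hasSum_coe_mul_geometric_of_norm_lt_one hn).mul_left 2)
  have h' : HasSum (fun j : ℕ => (M + 2 * j) * q ^ j) (M * (1 - q)⁻¹ + 2 * (q / (1 - q) ^ 2)) :=
    h.congr_fun fun j => by ring
  refine ⟨h'.summable, ?_⟩
  rw [h'.tsum_eq]
  have h1q : 0 < 1 - q := by linarith
  have hinv : (1 - q)⁻¹ ≤ M * (1 + 1 / δ) := by
    have h1 : 1 + δ / M ≤ q⁻¹ := by
      rw [hq, ← exp_neg, neg_div, neg_neg]
      linarith [add_one_le_exp (δ / M)]
    have h2 : q * (1 + δ / M) ≤ 1 := by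
      calc q * (1 + δ / M) ≤ q * q⁻¹ := by gcongr
        _ = 1 := mul_inv_cancel₀ hq0.ne'
    have h3 : (1 - q)⁻¹ ≤ 1 + M / δ := by
      rw [inv_le_iff_one_le_mul₀ h1q]
      have h4 : q * (M + δ) ≤ M := by
        calc q * (M + δ) = q * (1 + δ / M) * M := by field_simp
          _ ≤ 1 * M := by gcongr
          _ = M := one_mul M
      have h5 : 1 ≤ (1 + M / δ) * (1 - q) ↔ q * (M + δ) ≤ M := by
        rw [show (1 + M / δ) * (1 - q) = 1 + (M - q * (M + δ)) / δ by field_simp; ring]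
        rw [le_add_iff_nonneg_right, le_div_iff₀ hδ, zero_mul, sub_nonneg]
      exact h5.2 h4
    refine h3.trans ?_
    rw [mul_add, mul_one, mul_one_div]
    linarith
  have hsq : q / (1 - q) ^ 2 ≤ (M * (1 + 1 / δ)) ^ 2 := by
    calc q / (1 - q) ^ 2 ≤ 1 / (1 - q) ^ 2 := by gcongr
      _ = ((1 - q)⁻¹) ^ 2 := by rw [inv_pow, one_div]
      _ ≤ _ := by gcongr
  calc _ ≤ M * (M * (1 + 1 / δ)) + 2 * (M * (1 + 1 / δ)) ^ 2 := by gcongr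
    _ = _ := by ring

/-- Laplace's method for the positive series: its logarithm is the maximal rate up to a multiple of
`log m`, uniformly for `L` in a compact subset of `(0, ∞)`. -/
lemma log_amplitude_bound {d Lmin Lmax : ℝ} (hd : √2 < d) (hL0 : 0 < Lmin) :
    ∃ C : ℝ, 0 < C ∧ ∀ L ∈ Icc Lmin Lmax, ∀ m : ℕ, 5 ≤ m → Lmax ≤ m → ∀ T : ℝ,
      HasSum (amplitudeTerm d (m / L) m) T →
        0 < T ∧ |log T - rate d (m / L) m (Istar d L * m)| ≤ C * log m := by
  have hd0 : 0 < d := (Real.sqrt_nonneg 2).trans_lt hd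
  set δ := -log (1 / 2 + 1 / d ^ 2) with hδdef
  have hδ : 0 < δ := neg_log_half_add_pos hd
  set J := Istar d Lmin with hJdef
  have hJ : 0 < J := Istar_pos hd hL0
  set C₁ := 8 * π ^ 2 * d ^ 4 / Lmin * exp (2 * J * δ)
    * ((1 + 1 / δ) + 2 * (1 + 1 / δ) ^ 2) with hC₁
  set C₂ := 2 * π * d ^ 4 * exp (-log (d ^ 2 / 2))
    / (exp 2 * ((2 * J + 3) * ((2 * J + 3) ^ 2 + (1 / Lmin) ^ 2))) with hC₂
  have hC₁0 : 0 < C₁ := by positivity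
  have hC₂0 : 0 < C₂ := by positivity
  refine ⟨|log C₁| + |log C₂| + 3, by positivity, ?_⟩
  rintro L ⟨hL1, hL2⟩ m hm hLm T hT
  have hL : 0 < L := hL0.trans_le hL1
  have hm1 : (1 : ℝ) ≤ m := by exact_mod_cast (show 1 ≤ m by lia)
  have hm0 : (0 : ℝ) < m := by linarith
  have hξ : 1 ≤ (m : ℝ) / L := (one_le_div hL).2 (hL2.trans hLm)
  have hξ' : (m : ℝ) / L ≤ m / Lmin := by gcongr
  have hI := Istar_pos hd hL
  have hIJ : Istar d L ≤ J := Istar_anti hd hL0 hL1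
  set R := rate d (m / L) m (Istar d L * m) with hR
  rw [← hasSum_amplitudeTerm_iff d _ hm] at hT
  have hlogm : 1 ≤ log m := by
    rw [le_log_iff_exp_le hm0]
    have : (5 : ℝ) ≤ m := by exact_mod_cast hm
    linarith [exp_one_lt_d9]
  -- the upper bound, summing the linearly corrected bound for all terms
  have hup : T ≤ exp R * C₁ * (m : ℝ) ^ 3 := by
    obtain ⟨hs, hle⟩ := tsum_linear_mul_geometric_le hm1 hδ
    set A := 8 * π ^ 2 * d ^ 4 * (m / Lmin) * (exp R * exp (2 * J * δ)) with hA
    have hterm : ∀ j : ℕ, amplitudeTerm d (m / L) m (m - 5 + 2 * j)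
        ≤ A * (((m : ℝ) + 2 * j) * exp (-δ / m) ^ j) := by
      intro j
      have hr : rate d (m / L) m j ≤ R + 2 * J * δ + j * (-δ / m) := by
        have h := rate_le hd hL hm1 (Nat.cast_nonneg j)
        have e : δ / m * ((j : ℝ) - 2 * Istar d L * m)
            = -(j * (-δ / m)) - 2 * Istar d L * δ := by field_simp
        rw [← hδdef, ← hR, e] at h
        have : 2 * Istar d L * δ ≤ 2 * J * δ := by gcongr
        linarith
      calc _ ≤ 8 * π ^ 2 * d ^ 4 * (m / L) * ((m : ℝ) + 2 * j) * exp (rate d (m / L) m j) :=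
            amplitudeTerm_le hd0 hξ hm j
        _ ≤ 8 * π ^ 2 * d ^ 4 * (m / Lmin) * ((m : ℝ) + 2 * j)
            * exp (R + 2 * J * δ + j * (-δ / m)) := by gcongr
        _ = _ := by rw [exp_add, exp_add, exp_nat_mul, hA]; ring
    have h1 := hasSum_le hterm hT (hs.hasSum.mul_left A)
    calc T ≤ A * ((m : ℝ) ^ 2 * ((1 + 1 / δ) + 2 * (1 + 1 / δ) ^ 2)) := by
          refine h1.trans ?_
          gcongr
      _ = _ := by rw [hA, hC₁]; ring
  -- the lower bound, from the term next to the maximum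
  have hlow : exp R * C₂ / (m : ℝ) ^ 3 ≤ T := by
    set j := ⌈Istar d L * m⌉₊ with hj
    have hj1 : 1 ≤ j := Nat.one_le_iff_ne_zero.2 (Nat.ceil_pos.2 (by positivity)).ne'
    have hjl : Istar d L * m ≤ j := Nat.le_ceil _
    have hju : (j : ℝ) < Istar d L * m + 1 := Nat.ceil_lt_add_one (by positivity)
    have hrate : R - log (d ^ 2 / 2) ≤ rate d (m / L) m j := by
      have h := rate_add_mul_monotoneOn hd hL hm0 (mem_Ici.2 le_rfl) (mem_Ici.2 hjl) hjl
      simp only at h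
      have hlog : 0 ≤ log (d ^ 2 / 2) := log_nonneg (by linarith [two_mul_sq_sub_four_pos hd])
      nlinarith
    have hN : (m : ℝ) + 2 * j ≤ (2 * J + 3) * m := by
      have : Istar d L * m ≤ J * m := by gcongr
      nlinarith
    have h1 : amplitudeTerm d (m / L) m (m - 5 + 2 * j) ≤ T :=
      le_hasSum hT j fun i _ => (amplitudeTerm_pos hd0 (by positivity) hm i).le
    refine le_trans ?_ ((le_amplitudeTerm hd0 hξ hm hj1).trans h1)
    calc exp R * C₂ / (m : ℝ) ^ 3
        = 2 * π * d ^ 4 * exp (R - log (d ^ 2 / 2)) / (exp 2 * (((2 * J + 3) * m)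
          * (((2 * J + 3) * m) ^ 2 + (m / Lmin) ^ 2))) := by
          rw [hC₂, sub_eq_add_neg, exp_add]
          field_simp
      _ ≤ _ := by gcongr
  have hT0 : 0 < T := lt_of_lt_of_le (by positivity) hlow
  refine ⟨hT0, ?_⟩
  have l1 := log_le_log hT0 hup
  have l2 := log_le_log (by positivity) hlow
  rw [log_mul (by positivity) (by positivity), log_mul (by positivity) (by positivity), log_exp,
    log_pow] at l1
  rw [log_div (by positivity) (by positivity), log_mul (by positivity) (by positivity), log_exp,
    log_pow] at l2
  push_cast at l1 l2
  have a1 : |log C₁| ≤ |log C₁| * log m := le_mul_of_one_le_right (abs_nonneg _) hlogm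
  have a2 : |log C₂| ≤ |log C₂| * log m := le_mul_of_one_le_right (abs_nonneg _) hlogm
  have b1 := mul_nonneg (abs_nonneg (log C₁)) (zero_le_one.trans hlogm)
  have b2 := mul_nonneg (abs_nonneg (log C₂)) (zero_le_one.trans hlogm)
  have e : (|log C₁| + |log C₂| + 3) * log m
      = |log C₁| * log m + |log C₂| * log m + 3 * log m := by ring
  rw [e, abs_le]
  constructor
  · linarith [neg_abs_le (log C₂)]
  · linarith [le_abs_self (log C₁)]

/-! ### The amplitudes along a resonance -/

lemma sechFourier_abs (n : ℕ) (ξ : ℝ) : sechFourier n |ξ| = sechFourier n ξ := by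
  rcases abs_choice ξ with h | h
  · rw [h]
  · rw [h]; simp [sechFourier]

lemma amplitudeTerm_abs (d ξ : ℝ) (m : ℤ) : amplitudeTerm d |ξ| m = amplitudeTerm d ξ m := by
  ext k
  rw [amplitudeTerm, amplitudeTerm, sechFourier_abs]

/-- The integers `1, …, N - 1` stay at a positive distance from `γ ℤ`. -/
lemma exists_le_abs_sub_mul {γ : ℝ} (hγ : Irrational γ) (N : ℕ) :
    ∃ δ : ℝ, 0 < δ ∧ ∀ k : ℕ, 1 ≤ k → k < N → ∀ l : ℤ, δ ≤ |(k : ℝ) - γ * l| := by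
  have hγ0 : γ ≠ 0 := hγ.ne_zero
  induction N with
  | zero => exact ⟨1, one_pos, fun k _ h => absurd h (by lia)⟩
  | succ N ih =>
    obtain ⟨δ, hδ, h⟩ := ih
    rcases N.eq_zero_or_pos with rfl | hN
    · exact ⟨1, one_pos, fun k h1 h2 => absurd h2 (by lia)⟩
    have hirr : Irrational ((N : ℝ) / γ) := by
      have := hγ.inv.natCast_mul hN.ne'
      rwa [← div_eq_mul_inv] at this
    refine ⟨min δ (|γ| * |(N : ℝ) / γ - round ((N : ℝ) / γ)|), lt_min hδ ?_, ?_⟩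
    · exact mul_pos (abs_pos.2 hγ0) (abs_pos.2 (sub_ne_zero.2 (hirr.ne_int _)))
    · intro k h1 h2 l
      rcases (Nat.lt_succ_iff.1 h2).lt_or_eq with h3 | rfl
      · exact (min_le_left _ _).trans (h k h1 h3 l)
      · refine (min_le_right _ _).trans ?_
        calc |γ| * |(k : ℝ) / γ - round ((k : ℝ) / γ)| ≤ |γ| * |(k : ℝ) / γ - l| := by
              exact mul_le_mul_of_nonneg_left (round_le _ _) (abs_nonneg _)
          _ = |(k : ℝ) - γ * l| := by rw [← abs_mul]; congr 1; field_simp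

section Resonance

variable {c d γ ν : ℝ} {m : ℕ} {m₂ : ℤ}

lemma detuning_ne_zero (hγ : Irrational γ) (hm₂ : m₂ ≠ 0) :
    (m : ℝ) - γ * m₂ ≠ 0 := by
  intro h
  exact (hγ.mul_intCast hm₂).ne_nat m (by linarith)

lemma scaledL_eq (m₂ : ℤ) (hm : m ≠ 0) : scaledL γ ν m m₂ = ν * m / |(m : ℝ) - γ * m₂| := by
  have hm0 : (m : ℝ) ≠ 0 := by exact_mod_cast hm
  rw [scaledL, cs, Int.cast_natCast]
  rcases eq_or_ne |(m : ℝ) - γ * m₂| 0 with h | h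
  · simp [h]
  · field_simp

lemma abs_detuning_div (hγ : Irrational γ) (hν : 0 < ν) (hm : m ≠ 0) (hm₂ : m₂ ≠ 0) :
    |((m : ℝ) - γ * m₂) / ν| = m / scaledL γ ν m m₂ := by
  have hm0 : (m : ℝ) ≠ 0 := by exact_mod_cast hm
  have := abs_ne_zero.2 (detuning_ne_zero (m := m) hγ hm₂)
  rw [scaledL_eq m₂ hm, abs_div, abs_of_pos hν]
  field_simp

lemma sqrt_cs_mul (hm : m ≠ 0) (m₂ : ℤ) : √(cs γ m m₂ * ν) = √(scaledL γ ν m m₂) / m := by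
  have hm0 : (0 : ℝ) < m := by positivity
  rw [scaledL, Int.cast_natCast, Real.sqrt_mul' (cs γ m m₂ * ν) (sq_nonneg (m : ℝ)),
    Real.sqrt_sq hm0.le]
  field_simp

lemma C₂_eq (hc : 1 < c) (hd : √2 < d) (hγ : Irrational γ) (hν : 0 < ν) (hm : m ≠ 0)
    (hm₂ : m₂ ≠ 0) : C₂ c d γ ν m m₂ = C₁ c d γ ν m m₂ / scaledL γ ν m m₂ := by
  have hm0 : (0 : ℝ) < m := by positivity
  rw [C₂, C₁, fourierSinCoeff_G₂_eq hc hd hν γ (by exact_mod_cast hm), abs_mul, abs_div, abs_neg,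
    Int.cast_natCast, abs_detuning_div hγ hν hm hm₂, abs_of_pos hm0]
  field_simp

/-- The amplitude is a product of an explicit prefactor and the sum of the positive series. -/
lemma exists_C₁_eq (hc : 1 < c) (hd : √2 < d) (hγ : Irrational γ) (hν : 0 < ν) (hm : m ≠ 0)
    (hm₂ : m₂ ≠ 0) :
    ∃ T : ℝ, HasSum (amplitudeTerm d (m / scaledL γ ν m m₂) m) T ∧
      C₁ c d γ ν m m₂ = poissonFourier c 0 / (2 * π ^ 2) * (rho c)⁻¹ ^ m₂.natAbs * m * (1 / ν)
        * |T| := by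
  have hm0 : (0 : ℝ) < m := by positivity
  have hA := poissonFourier_zero_pos hc
  have hρ := one_lt_rho hc
  set P := poissonFourier c 0 / (2 * π ^ 2) * (rho c)⁻¹ ^ m₂.natAbs * m * (1 / ν) with hP
  have hP0 : 0 < P := by positivity
  have h := (hasSum_fourierSinCoeff_G₁ hc hd hν γ m m₂).mul_left P⁻¹
  refine ⟨P⁻¹ * fourierSinCoeff c d γ ν G₁ m m₂, ?_, ?_⟩
  · rw [← abs_detuning_div hγ hν hm hm₂, amplitudeTerm_abs]
    refine h.congr_fun fun k => ?_
    rw [poissonFourier_eq hc m₂, Int.cast_natCast]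
    rw [show ∀ X : ℝ, 1 / (2 * π ^ 2) * (poissonFourier c 0 * (rho c)⁻¹ ^ m₂.natAbs * (m / ν) * X)
      = P * X by intro X; rw [hP]; ring, inv_mul_cancel_left₀ hP0.ne']
  · rw [C₁, abs_mul, abs_of_pos (inv_pos.2 hP0), mul_inv_cancel_left₀ hP0.ne']

lemma abs_detuning_eq (hγ : Irrational γ) (hν : 0 < ν) (hm : m ≠ 0) (hm₂ : m₂ ≠ 0) :
    |(m : ℝ) - γ * m₂| = ν * m / scaledL γ ν m m₂ := by
  have hm0 : (0 : ℝ) < m := by positivity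
  have hω := abs_pos.2 (detuning_ne_zero (m := m) hγ hm₂)
  rw [scaledL_eq m₂ hm]; field_simp

/-- Along a resonance, the order `m₂` is close to `m / |γ|`. -/
lemma abs_natAbs_sub_le (hγ : Irrational γ) (hν : 0 < ν) (hm : m ≠ 0) (hm₂ : m₂ ≠ 0) :
    |(m₂.natAbs : ℝ) - m / (|γ|)| ≤ ν * m / (scaledL γ ν m m₂ * |γ|) := by
  have hm0 : (0 : ℝ) < m := by positivity
  have h1 : (m₂.natAbs : ℝ) = |(m₂ : ℝ)| := by rw [Nat.cast_natAbs, Int.cast_abs]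
  have h2 : (m : ℝ) / |γ| = |(m : ℝ) / γ| := by rw [abs_div, abs_of_pos hm0]
  rw [h1, h2]
  refine (abs_abs_sub_abs_le _ _).trans (le_of_eq ?_)
  have h3 : (m₂ : ℝ) - m / γ = -((m - γ * m₂) / γ) := by
    have := hγ.ne_zero
    field_simp
    ring
  rw [h3, abs_neg, abs_div, abs_detuning_eq hγ hν hm hm₂, div_div]

/-- For small `ν` the resonance condition forces a large order `m`. -/
lemma exists_forall_le_order (hγ : Irrational γ) {Lmin : ℝ} (hL0 : 0 < Lmin) (N : ℕ) :
    ∃ ν₀ : ℝ, 0 < ν₀ ∧ ∀ ν : ℝ, 0 < ν → ν < ν₀ → ∀ m : ℕ, m ≠ 0 → ∀ m₂ : ℤ, m₂ ≠ 0 →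
      Lmin ≤ scaledL γ ν m m₂ → N ≤ m := by
  obtain ⟨δ, hδ, hsep⟩ := exists_le_abs_sub_mul hγ N
  refine ⟨δ * Lmin / (N + 1), by positivity, ?_⟩
  intro ν hν hνν₀ m hm m₂ hm₂ hL
  by_contra hlt
  have hlt := not_le.1 hlt
  have h1 := hsep m (Nat.one_le_iff_ne_zero.2 hm) hlt m₂
  have h2 : ν * m / scaledL γ ν m m₂ ≤ ν * (N + 1) / Lmin := by
    have : (m : ℝ) ≤ N := by exact_mod_cast hlt.le
    have : (m : ℝ) ≤ N + 1 := by linarith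
    gcongr
  have h3 : ν * (N + 1) / Lmin < δ := by
    rw [lt_div_iff₀ (by positivity)] at hνν₀
    rwa [div_lt_iff₀ hL0]
  rw [abs_detuning_eq hγ hν hm hm₂] at h1
  linarith

/-- The logarithm of the first amplitude, given a bound for the logarithm of the positive series
`T`. -/
lemma abs_sub_log_C₁_le {C T : ℝ} (hc : 1 < c) (hd : √2 < d) (hγ : Irrational γ) (hν : 0 < ν)
    (hν3 : ν < 1 / 3) (hm : m ≠ 0) (hm₂ : m₂ ≠ 0) (hL : 0 < scaledL γ ν m m₂) (hC : 0 < C)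
    (hT0 : 0 < T)
    (hT : |log T - rate d (m / scaledL γ ν m m₂) m (Istar d (scaledL γ ν m m₂) * m)| ≤ C * log m)
    (hCT : C₁ c d γ ν m m₂
      = poissonFourier c 0 / (2 * π ^ 2) * (rho c)⁻¹ ^ m₂.natAbs * m * (1 / ν) * T) :
    |m * (Psi11 c d γ (scaledL γ ν m m₂) + Psi12 d (scaledL γ ν m m₂)) - log (C₁ c d γ ν m m₂)|
      ≤ (C + 2 + |log (poissonFourier c 0 / (2 * π ^ 2))|) * log (1 / ν) + (C + 1) * (m * ν)
        + ν * m / (scaledL γ ν m m₂ * |γ|) * log (rho c) := by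
  have hm0 : (0 : ℝ) < m := by positivity
  have hA0 := poissonFourier_zero_pos hc
  have hρ := one_lt_rho hc
  have hlogρ : 0 < log (rho c) := log_pos hρ
  have hq : 0 < (rho c)⁻¹ := by positivity
  have hlogC : log (C₁ c d γ ν m m₂) = log (poissonFourier c 0 / (2 * π ^ 2))
      - m₂.natAbs * log (rho c) + log m + log (1 / ν) + log T := by
    rw [hCT, log_mul (by positivity) hT0.ne', log_mul (by positivity) (by positivity),
      log_mul (by positivity) hm0.ne', log_mul (by positivity) (by positivity), log_pow, log_inv]
    ring
  have hR := rate_max_eq c γ hd hL hm0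
  have hν1 : 1 ≤ log (1 / ν) := by
    rw [le_log_iff_exp_le (by positivity), le_div_iff₀ hν]
    nlinarith [exp_one_lt_d9, exp_pos 1]
  have hlogm0 : 0 ≤ log m := log_nonneg (by exact_mod_cast Nat.one_le_iff_ne_zero.2 hm)
  -- if `m` is beyond `1 / ν`, its logarithm is absorbed by `m ν`
  have hlogm : log m ≤ log (1 / ν) + m * ν := by
    have h1 := log_le_sub_one_of_pos (show 0 < m * ν by positivity)
    rw [log_mul hm0.ne' hν.ne'] at h1
    rw [one_div, log_inv]
    linarith
  have hm₂γ := abs_natAbs_sub_le hγ hν hm hm₂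
  set L := scaledL γ ν m m₂
  set B := |log (poissonFourier c 0 / (2 * π ^ 2))| with hB
  set D := (m₂.natAbs : ℝ) - m / (|γ|) with hD
  set X := log T - rate d (m / L) m (Istar d L * m) with hX
  have e : m * (Psi11 c d γ L + Psi12 d L) - log (C₁ c d γ ν m m₂)
      = -X + D * log (rho c) + -(log m + log (1 / ν))
        + -log (poissonFourier c 0 / (2 * π ^ 2)) := by
    rw [hlogC, hX, hD, hR]; ring
  have t0 := abs_add_le (-X + D * log (rho c) + -(log m + log (1 / ν)))
    (-log (poissonFourier c 0 / (2 * π ^ 2)))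
  have t1 := abs_add_le (-X + D * log (rho c)) (-(log m + log (1 / ν)))
  have t2 := abs_add_le (-X) (D * log (rho c))
  have t3 : |D * log (rho c)| ≤ ν * m / (L * |γ|) * log (rho c) := by
    rw [abs_mul, abs_of_pos hlogρ]
    exact mul_le_mul_of_nonneg_right hm₂γ hlogρ.le
  have t4 : |-(log m + log (1 / ν))| = log m + log (1 / ν) := by
    rw [abs_neg, abs_of_nonneg (by linarith)]
  have t5 : B ≤ B * log (1 / ν) := le_mul_of_one_le_right (abs_nonneg _) hν1
  have t6 : C * log m ≤ C * (log (1 / ν) + m * ν) := mul_le_mul_of_nonneg_left hlogm hC.le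
  rw [abs_neg, ← hB] at t0
  rw [abs_neg] at t2
  rw [e]
  linarith

end Resonance

/-- Comparison of `Ψ₁(L)` with the first amplitude. A bound by `log m` for the series suffices,
since the normalization `√(c_s ν) = √L / m` turns it into `log m / m`. -/
lemma C₁_estimate {c d γ Lmin Lmax : ℝ} (hc : 1 < c) (hd : √2 < d) (hγ : Irrational γ)
    (hL0 : 0 < Lmin) :
    ∃ A ν₀ : ℝ, 0 < A ∧ 0 < ν₀ ∧ ν₀ < 1 ∧
      ∀ ν : ℝ, 0 < ν → ν < ν₀ → ∀ m : ℕ, m ≠ 0 → ∀ m₂ : ℤ, m₂ ≠ 0 →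
        scaledL γ ν m m₂ ∈ Icc Lmin Lmax →
          0 < C₁ c d γ ν m m₂ ∧
          |Psi1 c d γ (scaledL γ ν m m₂) - √(cs γ m m₂ * ν) * log (C₁ c d γ ν m m₂)|
            ≤ A * (√(cs γ m m₂ * ν) * log (1 / ν) + ν) := by
  have hγ0 : 0 < |γ| := abs_pos.2 hγ.ne_zero
  obtain ⟨C, hC, hbound⟩ := log_amplitude_bound (Lmax := Lmax) hd hL0
  obtain ⟨ν₁, hν₁, horder⟩ := exists_forall_le_order hγ hL0 (max 5 ⌈Lmax⌉₊)
  have hA0 := poissonFourier_zero_pos hc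
  have hρ := one_lt_rho hc
  have hlogρ : 0 < log (rho c) := log_pos hρ
  set B := |log (poissonFourier c 0 / (2 * π ^ 2))| with hB
  have hB0 : 0 ≤ B := abs_nonneg _
  refine ⟨(C + 2 + B) + √Lmax * (C + 1) + √Lmax * (log (rho c) / (Lmin * |γ|)),
    min (1 / 3) ν₁, by positivity, by positivity,
    (min_le_left _ _).trans_lt (by norm_num), ?_⟩
  intro ν hν hνν₀ m hm m₂ hm₂ hL
  have hLpos : 0 < scaledL γ ν m m₂ := hL0.trans_le hL.1
  have hm0 : (0 : ℝ) < m := by positivity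
  have hmN := horder ν hν (hνν₀.trans_le (min_le_right _ _)) m hm m₂ hm₂ hL.1
  have hm5 : 5 ≤ m := (le_max_left _ _).trans hmN
  have hmL : Lmax ≤ m := (Nat.le_ceil _).trans (by exact_mod_cast (le_max_right _ _).trans hmN)
  obtain ⟨T, hT, hCT⟩ := exists_C₁_eq hc hd hγ hν hm hm₂
  obtain ⟨hT0, hTb⟩ := hbound _ hL m hm5 hmL T hT
  rw [abs_of_pos hT0] at hCT
  have hq : 0 < (rho c)⁻¹ := by positivity
  refine ⟨by rw [hCT]; positivity, ?_⟩
  have hkey := abs_sub_log_C₁_le hc hd hγ hν (hνν₀.trans_le (min_le_left _ _)) hm hm₂ hLpos hC hT0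
    hTb hCT
  have hs := sqrt_cs_mul (γ := γ) (ν := ν) hm m₂
  have hs0 : 0 ≤ √(cs γ m m₂ * ν) := Real.sqrt_nonneg _
  have hlog : 0 ≤ log (1 / ν) := by
    refine log_nonneg ((one_le_div hν).2 ?_)
    linarith [hνν₀.trans_le (min_le_left _ _)]
  rw [← hB] at hkey
  clear hbound horder hTb hT hCT
  set L := scaledL γ ν m m₂
  set s := √(cs γ m m₂ * ν)
  have e1 : s * m = √L := by rw [hs]; field_simp
  have hPsi : Psi1 c d γ L = s * (m * (Psi11 c d γ L + Psi12 d L)) := by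
    rw [← mul_assoc, e1, Psi1]
  rw [hPsi, ← mul_sub, abs_mul, abs_of_nonneg hs0]
  have hsL : √L ≤ √Lmax := Real.sqrt_le_sqrt hL.2
  have hνlog : 0 ≤ s * log (1 / ν) := mul_nonneg hs0 hlog
  have u1 : √L * (C + 1) * ν ≤ √Lmax * (C + 1) * ν := by gcongr
  have u2 : √L * (log (rho c) / (L * |γ|)) * ν ≤ √Lmax * (log (rho c) / (Lmin * |γ|)) * ν := by
    have := hL.1
    gcongr
  have v1 : 0 ≤ √Lmax * (C + 1) := by positivity
  have v2 : 0 ≤ √Lmax * (log (rho c) / (Lmin * |γ|)) := by positivity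
  calc s * |m * (Psi11 c d γ L + Psi12 d L) - log (C₁ c d γ ν m m₂)|
      ≤ s * ((C + 2 + B) * log (1 / ν) + (C + 1) * (m * ν)
        + ν * m / (L * |γ|) * log (rho c)) := mul_le_mul_of_nonneg_left hkey hs0
    _ = (C + 2 + B) * (s * log (1 / ν)) + (s * m) * (C + 1) * ν
        + (s * m) * (log (rho c) / (L * |γ|)) * ν := by ring
    _ ≤ (C + 2 + B) * (s * log (1 / ν)) + √Lmax * (C + 1) * ν
        + √Lmax * (log (rho c) / (Lmin * |γ|)) * ν := by rw [e1]; linarith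
    _ ≤ (C + 2 + B + √Lmax * (C + 1) + √Lmax * (log (rho c) / (Lmin * |γ|)))
        * (s * log (1 / ν)) + (C + 2 + B + √Lmax * (C + 1)
          + √Lmax * (log (rho c) / (Lmin * |γ|))) * ν := by
        have w : 0 ≤ C + 2 + B := by positivity
        rw [add_assoc]
        refine add_le_add (mul_le_mul_of_nonneg_right (by linarith) hνlog) ?_
        rw [← add_mul]
        exact mul_le_mul_of_nonneg_right (by linarith) hν.le
    _ = _ := by ring

/-- Passing from `G₁` to `G₂` changes both sides by `√L log L / m₁`. -/
lemma Psi2_sub_eq {c d γ ν : ℝ} {m : ℕ} {m₂ : ℤ} (hc : 1 < c) (hd : √2 < d) (hγ : Irrational γ)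
    (hν : 0 < ν) (hm : m ≠ 0) (hm₂ : m₂ ≠ 0) (hL : 0 < scaledL γ ν m m₂)
    (hC : 0 < C₁ c d γ ν m m₂) :
    Psi2 c d γ m (scaledL γ ν m m₂) - √(cs γ m m₂ * ν) * log (C₂ c d γ ν m m₂)
      = Psi1 c d γ (scaledL γ ν m m₂) - √(cs γ m m₂ * ν) * log (C₁ c d γ ν m m₂) := by
  rw [C₂_eq hc hd hγ hν hm hm₂, log_div hC.ne' hL.ne', Psi2, sqrt_cs_mul hm, Int.cast_natCast]
  ring

lemma tendsto_zero_of_abs_le {ν s f : ℕ → ℝ} {A : ℝ} (hν : Tendsto ν atTop (𝓝 0))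
    (hs : Tendsto (fun n => s n * log (ν n)) atTop (𝓝 0))
    (h : ∀ᶠ n in atTop, |f n| ≤ A * (s n * log (1 / ν n) + ν n)) : Tendsto f atTop (𝓝 0) := by
  refine squeeze_zero_norm' h ?_
  have := (hs.neg.add hν).const_mul A
  simp only [neg_zero, add_zero, mul_zero] at this
  refine this.congr fun n => ?_
  rw [one_div, log_inv]
  ring

end HamiltonianHopf

theorem theorem1 (c d : ℝ) (hc : 1 < c) (hd : √2 < d) :
    (∃ Φ : ℝ → ℝ, ∀ γ L : ℝ, Psi1 c d γ L = Φ L - √L * (log (c + √(c ^ 2 - 1)) / |γ|)) ∧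
    ∀ γ : ℝ, Irrational γ → ∀ Lmin Lmax : ℝ, 0 < Lmin → Lmin ≤ Lmax →
      (∃ A ν₀ : ℝ, 0 < A ∧ 0 < ν₀ ∧ ν₀ < 1 ∧
        ∀ ν : ℝ, 0 < ν → ν < ν₀ → ∀ m₁ m₂ : ℤ, 0 < m₁ → m₂ ≠ 0 →
          scaledL γ ν m₁ m₂ ∈ Set.Icc Lmin Lmax →
            0 < C₁ c d γ ν m₁ m₂ ∧ 0 < C₂ c d γ ν m₁ m₂ ∧
            |Psi1 c d γ (scaledL γ ν m₁ m₂) - √(cs γ m₁ m₂ * ν) * log (C₁ c d γ ν m₁ m₂)|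
              ≤ A * (√(cs γ m₁ m₂ * ν) * log (1 / ν) + ν) ∧
            |Psi2 c d γ m₁ (scaledL γ ν m₁ m₂) - √(cs γ m₁ m₂ * ν) * log (C₂ c d γ ν m₁ m₂)|
              ≤ A * (√(cs γ m₁ m₂ * ν) * log (1 / ν) + ν)) ∧
      (∀ (ν : ℕ → ℝ) (m₁ m₂ : ℕ → ℤ),
        (∀ n, 0 < ν n ∧ 0 < m₁ n ∧ m₂ n ≠ 0 ∧
          scaledL γ (ν n) (m₁ n) (m₂ n) ∈ Set.Icc Lmin Lmax) →
        Tendsto ν atTop (𝓝 0) →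
        Tendsto (fun n => √(cs γ (m₁ n) (m₂ n) * ν n) * log (ν n)) atTop (𝓝 0) →
          Tendsto (fun n => Psi1 c d γ (scaledL γ (ν n) (m₁ n) (m₂ n))
            - √(cs γ (m₁ n) (m₂ n) * ν n) * log (C₁ c d γ (ν n) (m₁ n) (m₂ n)))
            atTop (𝓝 0) ∧
          Tendsto (fun n => Psi2 c d γ (m₁ n) (scaledL γ (ν n) (m₁ n) (m₂ n))
            - √(cs γ (m₁ n) (m₂ n) * ν n) * log (C₂ c d γ (ν n) (m₁ n) (m₂ n)))
            atTop (𝓝 0)) := by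
  refine ⟨⟨fun L => √L * (-(log d + log 2 / 2 - 1 + log L + π / 2 / L) + Psi12 d L),
    fun γ L => ?_⟩, ?_⟩
  · rw [Psi1, Psi11, K, rho]; ring
  intro γ hγ Lmin Lmax hL0 _
  obtain ⟨A, ν₀, hA, hν₀, hν₀1, hest⟩ := C₁_estimate (Lmax := Lmax) hc hd hγ hL0
  have hboth : ∀ ν : ℝ, 0 < ν → ν < ν₀ → ∀ m₁ m₂ : ℤ, 0 < m₁ → m₂ ≠ 0 →
      scaledL γ ν m₁ m₂ ∈ Set.Icc Lmin Lmax →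
        0 < C₁ c d γ ν m₁ m₂ ∧ 0 < C₂ c d γ ν m₁ m₂ ∧
        |Psi1 c d γ (scaledL γ ν m₁ m₂) - √(cs γ m₁ m₂ * ν) * log (C₁ c d γ ν m₁ m₂)|
          ≤ A * (√(cs γ m₁ m₂ * ν) * log (1 / ν) + ν) ∧
        |Psi2 c d γ m₁ (scaledL γ ν m₁ m₂) - √(cs γ m₁ m₂ * ν) * log (C₂ c d γ ν m₁ m₂)|
          ≤ A * (√(cs γ m₁ m₂ * ν) * log (1 / ν) + ν) := by
    intro ν hν hνν₀ m₁ m₂ hm₁ hm₂ hL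
    lift m₁ to ℕ using hm₁.le
    have hm : m₁ ≠ 0 := by lia
    obtain ⟨hC, hb⟩ := hest ν hν hνν₀ m₁ hm m₂ hm₂ hL
    have hLpos := hL0.trans_le hL.1
    refine ⟨hC, ?_, hb, ?_⟩
    · rw [C₂_eq hc hd hγ hν hm hm₂]; positivity
    · rwa [Psi2_sub_eq hc hd hγ hν hm hm₂ hLpos hC]
  refine ⟨⟨A, ν₀, hA, hν₀, hν₀1, hboth⟩, ?_⟩
  intro ν m₁ m₂ h hν hs
  have hev : ∀ᶠ n in atTop, ν n < ν₀ := hν.eventually_lt_const hν₀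
  constructor
  · refine tendsto_zero_of_abs_le (A := A) hν hs (hev.mono fun n hn => ?_)
    obtain ⟨h1, h2, h3, h4⟩ := h n
    exact (hboth (ν n) h1 hn (m₁ n) (m₂ n) h2 h3 h4).2.2.1
  · refine tendsto_zero_of_abs_le (A := A) hν hs (hev.mono fun n hn => ?_)
    obtain ⟨h1, h2, h3, h4⟩ := h n
    exact (hboth (ν n) h1 hn (m₁ n) (m₂ n) h2 h3 h4).2.2.2
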